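/- **Setting.** Let $\delta\ge 1$ be an integer. An *LCL problem* is a triple $\Pi=(\delta,\Sigma,\mathcal C)$ with $\Sigma$ a finite set of labels and $\mathcal C\subseteq\Sigma^{\delta+1}$ a set of allowed configurations, written $(a:b_1\dots b_\delta)$. The inputs are the finite full $\delta$-ary rooted trees (every node has exactly $\delta$ or $0$ children). A *solution* of $\Pi$ on a tree $T$ is a map $\lambda$ from the nodes to $\Sigma$ such that for every node $v$ with $\delta$ children $v_1,\dots,v_\delta$ there is a permutation $\rho$ with $(\lambda(v):\lambda(v_{\rho(1)})\dots\lambda(v_{\rho(\delta)}))\in\mathcal C$; leaves impose no constraint of their own. **Certificate.** The automaton $\mathcal M(\Pi)$ is the directed graph on $\Sigma$ with an edge $a\to b$ whenever some $(a:b_1\dots b_\delta)\in\mathcal C$ has $b=b_i$ for some $i$. A label $a$ is *path-flexible* in $\Pi$ if there is $K\in\mathbb N$ such that for every $k\ge K$ there is a walk $a\leadsto a$ of length exactly $k$ in $\mathcal M(\Pi)$. Set $\Pi_0=\Pi$ and let $\Pi_{i+1}$ be the restriction of $\Pi_i$ to the set of its path-flexible labels (keep those labels and exactly the configurations that use only them).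 Since $\Sigma$ is finite, this sequence reaches a fixed point; $\Pi$ *has a certificate for $O(\log n)$ solvability* if the set of labels of this fixed point is non-empty. **Model.** In the deterministic $\mathsf{CONGEST}$ model, the nodes of an $n$-node tree have distinct identifiers in $\{1,\dots,p(n)\}$ for a fixed polynomial $p$. Each node initially knows $n$, the maximum degree, its own identifier, its degree, and which of its incident edges (if any) leads to its parent; the edges to its children are distinguished by arbitrary port numbers. In each synchronous round every node sends a message of $O(\log n)$ bits along each incident edge, receives its neighbors' messages, and performs arbitrary deterministic local computation. At the end every node outputs a label. **Theorem.** Let $\Pi$ be an LCL problem having a certificate for $O(\log n)$ solvability. Then $\Pi$ is solvable deterministically in $O(\log n)$ rounds in the $\mathsf{CONGEST}$ model: for every polynomial $p$ there is a deterministic $\mathsf{CONGEST}$ algorithm which, on every full $\delta$-ary rooted tree, with every assignment of distinct identifiers in $\{1,\dots,p(n)\}$ and every port numbering, where $n$ is the number of nodes, outputs a solution of $\Pi$ after $O(\log n)$ rounds. The constants in the $O(\cdot)$ bounds may depend on $\Pi$ and $p$. -/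

import Mathlib

universe u

/-! ### Locally checkable problems on rooted regular trees -/

/-- An LCL problem `(δ, Σ, 𝒞)`: a finite set `labels` of labels (inside an ambient type `α`) and a
set `configs` of allowed configurations `(a : b₁ … b_δ)`, which use labels from `labels` only. -/
@[ext]
structure LCL (δ : ℕ) (α : Type u) where
  labels : Set α
  finite_labels : labels.Finite
  configs : Set (α × (Fin δ → α))
  mem_labels : ∀ c ∈ configs, c.1 ∈ labels ∧ ∀ i, c.2 i ∈ labels

namespace LCL

variable {δ : ℕ} {α : Type u}

/-- The restriction of `P` to the labels in `S`: keep exactly the configurations that only use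
labels in `S`. -/
def restrict (P : LCL δ α) (S : Set α) : LCL δ α where
  labels := P.labels ∩ S
  finite_labels := P.finite_labels.inter_of_left S
  configs := {c | c ∈ P.configs ∧ c.1 ∈ S ∧ ∀ i, c.2 i ∈ S}
  mem_labels := fun c hc =>
    ⟨⟨(P.mem_labels c hc.1).1, hc.2.1⟩, fun i => ⟨(P.mem_labels c hc.1).2 i, hc.2.2 i⟩⟩

/-- The path-form of `P`: the problem with one child per node in which `(a : b)` is allowed iff
some configuration `(a : b₁ … b_δ)` of `P` has `b = bᵢ` for some `i`. -/
def pathForm (P : LCL δ α) : LCL 1 α where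
  labels := P.labels
  finite_labels := P.finite_labels
  configs := {c | ∃ d ∈ P.configs, d.1 = c.1 ∧ ∃ i, d.2 i = c.2 0}
  mem_labels := by
    rintro ⟨a, b⟩ ⟨d, hd, h1, i, h2⟩
    refine ⟨h1 ▸ (P.mem_labels d hd).1, fun j => ?_⟩
    rw [Subsingleton.elim j 0, ← h2]
    exact (P.mem_labels d hd).2 i

/-- The transition relation of the automaton associated with the path-form of `P`; its states are
the labels of `P`. -/
def Transition (P : LCL δ α) (a b : α) : Prop :=
  (a, fun _ => b) ∈ P.pathForm.configs

/-- `P.HasWalk k a b`: the automaton of `P` has a walk from `a` to `b` of length exactly `k`. -/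
def HasWalk (P : LCL δ α) : ℕ → α → α → Prop
  | 0, a, b => a = b
  | k + 1, a, b => ∃ c, P.Transition a c ∧ P.HasWalk k c b

/-- A label `a` of `P` is path-flexible if, for all sufficiently large `k`, the automaton of `P`
has a walk from `a` to `a` of length exactly `k`. -/
def PathFlexible (P : LCL δ α) (a : α) : Prop :=
  a ∈ P.labels ∧ ∃ K : ℕ, ∀ k, K ≤ k → P.HasWalk k a a

/-- One pruning step: the restriction of `P` to its path-flexible labels. -/
def removePathInflexible (P : LCL δ α) : LCL δ α :=
  P.restrict {a | P.PathFlexible a}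

/-- The problem obtained from `P` after `i` pruning steps. -/
def pruned (P : LCL δ α) (i : ℕ) : LCL δ α :=
  removePathInflexible^[i] P

/-- `P` has a certificate for `O(log n)` solvability: the iterated pruning of path-inflexible
labels reaches a fixed point (it always does, as there are finitely many labels) whose set of
labels is non-empty. -/
def HasLogCertificate (P : LCL δ α) : Prop :=
  ∃ i, P.pruned (i + 1) = P.pruned i ∧ (P.pruned i).labels.Nonempty

end LCL

/-! ### Input trees

A rooted tree is Mathlib's `RootedTree`: the order is the ancestor order, the root is `⊥`, the
parent of a node `v ≠ ⊥` is `Order.pred v`, and `u` is a child of `v` iff `v ⋖ u`. -/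

/-- `T` is a full `δ`-ary tree: each node has either exactly `δ` or exactly `0` children. -/
def RootedTree.IsFull (T : RootedTree.{0}) (δ : ℕ) : Prop :=
  ∀ v : T, {u : T | v ⋖ u}.encard = δ ∨ {u : T | v ⋖ u} = ∅

/-- The degree of `v`: the number of its children, plus one for the parent unless `v` is the
root. -/
noncomputable def RootedTree.degree (T : RootedTree.{0}) (v : T) : ℕ :=
  open Classical in {u : T | v ⋖ u}.ncard + if v = ⊥ then 0 else 1

/-- The labeling `lab` of the nodes of `T` is a solution to `P`: every node gets a label of `P`,
and for each node `v` with `δ` children, listed as `c 0, …, c (δ - 1)`, some permutation of this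
list yields an allowed configuration. -/
def LCL.IsSolution {δ : ℕ} {α : Type u} (P : LCL δ α) (T : RootedTree.{0}) (lab : T → α) : Prop :=
  (∀ v, lab v ∈ P.labels) ∧
  ∀ (v : T) (c : Fin δ → T), Function.Injective c → Set.range c = {u : T | v ⋖ u} →
    ∃ ρ : Equiv.Perm (Fin δ), (lab v, fun i => lab (c (ρ i))) ∈ P.configs

/-! ### The CONGEST model -/

/-- The communication ports of a node: one towards its parent and `δ` towards its children. -/
inductive Port (δ : ℕ) : Type
  | parent : Port δ
  | child (i : Fin δ) : Port δ

/-- A network: the tree `T`, whose nodes have distinct identifiers, and where the children of each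
node are attached to distinct child ports of that node, in an arbitrary way. (The value of `port`
at the root is not used.) -/
structure Network (δ : ℕ) (T : RootedTree.{0}) where
  ident : T → ℕ
  ident_injective : Function.Injective ident
  port : T → Fin δ
  port_injective : ∀ v u w : T, v ⋖ u → v ⋖ w → port u = port w → u = w

/-- The initial knowledge of a node. -/
structure NodeInput where
  /-- the number of nodes of the tree -/
  size : ℕ
  /-- the maximum degree of the tree -/
  maxDegree : ℕ
  /-- the identifier of the node -/
  ident : ℕ
  /-- the degree of the node -/
  degree : ℕ
  /-- whether the node has a parent -/
  hasParent : Bool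

/-- A deterministic synchronous message-passing algorithm with outputs in `α`. Messages are bit
strings. In each round every node sends a message through each of its ports, receives the messages
of its neighbors, and updates its state by an arbitrary function. -/
structure DistAlgorithm (δ : ℕ) (α : Type u) where
  State : Type u
  init : NodeInput → State
  send : State → Port δ → List Bool
  update : State → (Port δ → Option (List Bool)) → State
  output : State → α

namespace Network

variable {δ : ℕ} {T : RootedTree.{0}}

open Classical in
/-- The initial knowledge of the node `v`. -/
noncomputable def input [Fintype T] (N : Network δ T) (v : T) : NodeInput where
  size := Fintype.card T
  maxDegree := Finset.univ.sup T.degree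
  ident := N.ident v
  degree := T.degree v
  hasParent := decide (v ≠ ⊥)

open Classical in
/-- The messages that `v` receives when each node `u` sends `out u q` through its port `q`; there is
no message (`none`) at a port that is not connected to a neighbor. -/
noncomputable def inbox (N : Network δ T) (out : T → Port δ → List Bool) (v : T) :
    Port δ → Option (List Bool)
  | .parent => if v = ⊥ then none else some (out (Order.pred v) (.child (N.port v)))
  | .child i =>
      if h : ∃ u, v ⋖ u ∧ N.port u = i then some (out h.choose .parent) else none

end Network

/-- The state of the node `v` after `t` rounds of `A` on the network `N`. -/
noncomputable def DistAlgorithm.state {δ : ℕ} {α : Type u} (A : DistAlgorithm δ α)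
    {T : RootedTree.{0}} [Fintype T] (N : Network δ T) : ℕ → T → A.State
  | 0, v => A.init (N.input v)
  | t + 1, v => A.update (A.state N t v) (N.inbox (fun u => A.send (A.state N t u)) v)

/-- `P` is deterministically solvable in `O(f(n))` rounds in the CONGEST model on full `δ`-ary
trees: for every polynomial range `{1, …, p(n)}` of identifiers there is an algorithm which, on each
`n`-node tree, uses messages of `O(log n)` bits and stops after `O(f(n))` rounds with a solution. -/
def LCL.SolvableInCongest {δ : ℕ} {α : Type u} (P : LCL δ α) (f : ℕ → ℝ) : Prop :=
  ∀ p : Polynomial ℕ, ∃ (A : DistAlgorithm δ α) (rounds bits : ℕ → ℕ),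
    (fun n => (rounds n : ℝ)) =O[Filter.atTop] f ∧
    (fun n => (bits n : ℝ)) =O[Filter.atTop] (fun n : ℕ => Real.log n) ∧
    ∀ (T : RootedTree.{0}) [Fintype T], T.IsFull δ →
      ∀ N : Network δ T, (∀ v, N.ident v ∈ Finset.Icc 1 (p.eval (Fintype.card T))) →
        (∀ t < rounds (Fintype.card T), ∀ (v : T) (q : Port δ),
          (A.send (A.state N t v) q).length ≤ bits (Fintype.card T)) ∧
        P.IsSolution T (fun v => A.output (A.state N (rounds (Fintype.card T)) v))

/-! Pruning to path-flexible labels and passing to a component that no walk leaves gives a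
subproblem `Q`, a label `s` and one length `K` such that every label of `Q` has a configuration in
`Q` and a walk to `s` of length exactly `K` (`LCL.HasLogCertificate.exists_absorbing`). So a path of
at least `K` edges can be labeled downwards from any label so as to end in `s`, and children off the
path take whatever the configurations give them. It remains to cut the tree at anchors, all labeled
`s`, so that a node has at most one child to respect and every downward path has logarithmically
many edges between the root or an anchor and the next place where it is cut.

The anchors come from two ingredients with `D = K + 1`. Cole–Vishkin colors of the identifiers of
ancestors define a set `Y` whose members are more than `D` apart on every upward path, while every
upward path of constant length meets `Y` or the root. Raking and compressing then runs on the
clusters cut out by `Y`: a node of `Y` stays alive only while it sees two alive nodes of `Y` right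
below its cluster. Being alive for another constant number of rounds thus doubles the subtree size,
so every count falls below 2 within `O(log n)` rounds (`Network.count_lt_two`). At that moment a
node has at most one contributing child, and it points to it.

An anchor is a node of `Y` with `D` pointer edges directly above it. Along an upward path without
anchors or the root, the settling times keep growing with the length of the path, and they are at
most `O(log n)`; hence anchors are frequent (`Network.exists_anchor_above`). Every node measures its
pointer distance `d` to an anchor, up to `K`, and labels flow down so that a node with `d ≤ K` has a
walk of length `d` to `s`. This is free at `d = K`, is maintained along pointers, and at `d = 0`
forces the label `s` (`Network.isSolution_of_stable`). Anchors can therefore output `s` without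
waiting for their parents. -/

/-! ### Symmetry breaking along sequences of identifiers -/

namespace ColeVishkin

/-- The least position at which the binary expansions of `a` and `b` differ. -/
noncomputable def firstDiff (a b : ℕ) : ℕ := sInf {k | a.testBit k ≠ b.testBit k}

/-- The Cole–Vishkin color reduction: the first position where the color `a` differs from the color
`b` of the successor, together with the bit of `a` at this position. -/
noncomputable def recolor (a b : ℕ) : ℕ :=
  2 * firstDiff a b + (a.testBit (firstDiff a b)).toNat

lemma testBit_firstDiff_ne {a b : ℕ} (h : a ≠ b) :
    a.testBit (firstDiff a b) ≠ b.testBit (firstDiff a b) := by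
  have hne : {k | a.testBit k ≠ b.testBit k}.Nonempty := by
    by_contra hempty
    rw [Set.not_nonempty_iff_eq_empty, Set.eq_empty_iff_forall_notMem] at hempty
    exact h (Nat.eq_of_testBit_eq fun k => not_not.1 (hempty k))
  exact Nat.sInf_mem hne

/-- Equal new colors would give the same position and the same bit of `a` and `b` there, although
`a` and `b` differ at that position. -/
lemma recolor_ne {a b c : ℕ} (hab : a ≠ b) : recolor a b ≠ recolor b c := by
  intro h
  have hab' := testBit_firstDiff_ne hab
  unfold recolor at h
  have h1 := Bool.toNat_lt (a.testBit (firstDiff a b))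
  have h2 := Bool.toNat_lt (b.testBit (firstDiff b c))
  have hk : firstDiff a b = firstDiff b c := by omega
  rw [← hk] at h
  have h3 : (a.testBit (firstDiff a b)).toNat = (b.testBit (firstDiff a b)).toNat := by omega
  exact hab' (by revert h3; cases a.testBit (firstDiff a b) <;> cases b.testBit (firstDiff a b) <;> simp)

lemma recolor_lt {a b m : ℕ} (hab : a ≠ b) (ha : a < 2 ^ m) (hb : b < 2 ^ m) :
    recolor a b < 2 * m := by
  have hab' := testBit_firstDiff_ne hab
  have hk : firstDiff a b < m := by
    by_contra! hk
    have hpow : 2 ^ m ≤ 2 ^ firstDiff a b := Nat.pow_le_pow_right (by norm_num) hk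
    exact hab' (by rw [Nat.testBit_lt_two_pow (ha.trans_le hpow),
      Nat.testBit_lt_two_pow (hb.trans_le hpow)])
  have h1 := Bool.toNat_lt (a.testBit (firstDiff a b))
  unfold recolor
  omega

/-- The color of the first entry of the sequence `a` after `s` reduction steps, where the successor
of an entry is the entry `j` places further. -/
noncomputable def color (j : ℕ) : ℕ → (ℕ → ℕ) → ℕ
  | 0, a => a 0
  | s + 1, a => recolor (color j s a) (color j s fun i => a (i + j))

lemma color_congr {j s : ℕ} {a b : ℕ → ℕ} (h : ∀ i ≤ j * s, a i = b i) :
    color j s a = color j s b := by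
  induction s generalizing a b with
  | zero => exact h 0 (by simp)
  | succ s ih =>
    rw [Nat.mul_succ] at h
    unfold color
    rw [ih fun i hi => h i (by omega), ih fun i hi => h (i + j) (by omega)]

lemma injective_shift {a : ℕ → ℕ} (ha : a.Injective) (j : ℕ) :
    Function.Injective fun i => a (i + j) :=
  fun x y h => by simpa using ha h

lemma color_ne {j : ℕ} (hj : 0 < j) (s : ℕ) {a : ℕ → ℕ} (ha : a.Injective) :
    color j s a ≠ color j s fun i => a (i + j) := by
  induction s generalizing a with
  | zero =>
    intro h
    have := ha h
    omega
  | succ s ih => exact recolor_ne (ih ha)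

/-- A step turns `m`-bit colors into colors below `2 * m ≤ 2 ^ (m - 1)` for `m ≥ 4`, and 3 bits stay
3 bits. Losing one bit per step is cruder than the usual iterated-logarithm analysis, but `O(log n)`
steps are affordable here. -/
lemma color_lt {j : ℕ} (hj : 0 < j) (s m : ℕ) {a : ℕ → ℕ} (ha : a.Injective)
    (hm : ∀ i ≤ j * s, a i < 2 ^ m) : color j s a < 2 ^ max (m - s) 3 := by
  induction s generalizing a with
  | zero => exact (hm 0 (by simp)).trans_le (Nat.pow_le_pow_right (by norm_num) (by simp))
  | succ s ih =>
    rw [Nat.mul_succ] at hm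
    have h1 := ih ha fun i hi => hm i (by omega)
    have h2 := ih (injective_shift ha j) fun i hi => hm (i + j) (by omega)
    refine (recolor_lt (color_ne hj s ha) h1 h2).trans_le ?_
    rcases Nat.lt_or_ge (m - s) 4 with h | h
    · rw [max_eq_right (by omega), max_eq_right (by omega)]
      norm_num
    · obtain ⟨x, hx⟩ := Nat.exists_eq_add_of_le h
      have hx' : m - (s + 1) = x + 3 := by omega
      rw [max_eq_left (by omega), max_eq_left (by omega), hx, hx', pow_add]
      have := Nat.lt_two_pow_self (n := x)
      omega

/-- The colors of the first entry of `a` with respect to the entries at distances `1, …, D`,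
packed into one number. -/
noncomputable def fullColor (D s : ℕ) (a : ℕ → ℕ) : ℕ :=
  (finFunctionFinEquiv fun j : Fin D =>
    (⟨color (j + 1) s a % 8, Nat.mod_lt _ (by norm_num)⟩ : Fin 8)).val

lemma fullColor_lt (D s : ℕ) (a : ℕ → ℕ) : fullColor D s a < 8 ^ D := Fin.is_lt _

lemma fullColor_congr {D s : ℕ} {a b : ℕ → ℕ} (h : ∀ i ≤ D * s, a i = b i) :
    fullColor D s a = fullColor D s b := by
  unfold fullColor
  congr 2
  funext j
  have : color (j + 1) s a = color (j + 1) s b :=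
    color_congr fun i hi => h i (hi.trans (Nat.mul_le_mul_right s j.is_lt))
  simp [this]

/-- The coordinate for distance `j` alone separates the two. Since `s` is both the bit length and
the number of steps, the colors are below 8 and reducing modulo 8 loses nothing. -/
lemma fullColor_ne {D s j : ℕ} (hj : 0 < j) (hjD : j ≤ D) {a : ℕ → ℕ} (ha : a.Injective)
    (hs : ∀ i ≤ j + D * s, a i < 2 ^ s) :
    fullColor D s a ≠ fullColor D s fun i => a (i + j) := by
  intro h
  have h1 := congrFun (finFunctionFinEquiv.injective (Fin.ext h)) ⟨j - 1, by omega⟩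
  have hj1 : j - 1 + 1 = j := by omega
  have hle : j * s ≤ D * s := Nat.mul_le_mul_right s hjD
  simp only [hj1, Fin.mk.injEq] at h1
  have h2 := color_lt hj s s ha fun i hi => hs i (by omega)
  have h3 := color_lt hj s s (injective_shift ha j) fun i hi => hs (i + j) (by omega)
  norm_num only [Nat.sub_self, Nat.zero_max] at h2 h3
  rw [Nat.mod_eq_of_lt h2, Nat.mod_eq_of_lt h3] at h1
  exact color_ne hj s ha h1

/-- The entry at position `D` of `a` has the strictly largest color among the entries at distance
at most `D` from it. -/
def IsRuler (D s : ℕ) (a : ℕ → ℕ) : Prop :=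
  ∀ j ≤ 2 * D, j ≠ D → fullColor D s (fun i => a (i + j)) < fullColor D s fun i => a (i + D)

lemma isRuler_congr {D s : ℕ} {a b : ℕ → ℕ} (h : ∀ i ≤ 2 * D + D * s, a i = b i) :
    IsRuler D s a ↔ IsRuler D s b := by
  have key : ∀ j ≤ 2 * D, fullColor D s (fun i => a (i + j)) = fullColor D s fun i => b (i + j) :=
    fun j hj => fullColor_congr fun i hi => h _ (by omega)
  unfold IsRuler
  rw [key D (by omega)]
  exact forall₂_congr fun j hj => by rw [key j hj]

/-- Each of the two centers lies in the window of the other, so each color would have to exceed the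
other. -/
lemma IsRuler.not_isRuler_shift {D s e : ℕ} {a : ℕ → ℕ} (he : 0 < e) (heD : e ≤ D)
    (h : IsRuler D s a) : ¬ IsRuler D s fun i => a (i + e) := by
  intro h'
  have h1 := h (D + e) (by omega) (by omega)
  have h2 := h' (D - e) (by omega) (by omega)
  have e1 : ∀ i, i + (D - e) + e = i + D := by omega
  have e2 : ∀ i, i + D + e = i + (D + e) := by omega
  simp only [e1, e2] at h2
  omega

/-- Hill climbing: a position that is not a strict local maximum has one of strictly larger color
within distance `D`, ties being excluded by `fullColor_ne`. Colors are below `8 ^ D`, so the climb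
ends. -/
lemma exists_isRuler_shift {D s : ℕ} {a : ℕ → ℕ} (ha : a.Injective)
    (hs : ∀ i ≤ 2 * 8 ^ D * D + 2 * D + D * s, a i < 2 ^ s) :
    ∃ i ≤ 2 * 8 ^ D * D, IsRuler D s fun k => a (k + i) := by
  set c : ℕ → ℕ := fun x => fullColor D s fun i => a (i + x) with hc
  have hne : ∀ x y, x < y → y ≤ x + D → y ≤ 2 * 8 ^ D * D + 2 * D → c x ≠ c y := by
    intro x y hxy hyD hy
    have := fullColor_ne (D := D) (s := s) (j := y - x) (by omega) (by omega)
      (injective_shift ha x) fun i hi => hs (i + x) (by omega)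
    have e : ∀ i, i + (y - x) + x = i + y := by omega
    simpa only [e] using this
  -- Here `k` bounds the number of moves left, and the two bounds on `x` keep the window around `x`
  -- inside the controlled range.
  have key : ∀ k x, 8 ^ D ≤ c x + k → (k + 1) * D ≤ x → x + k * D ≤ 2 * 8 ^ D * D + D →
      ∃ i, i ≤ 2 * 8 ^ D * D ∧ IsRuler D s fun k => a (k + i) := by
    intro k
    induction k with
    | zero =>
      intro x hx
      have := fullColor_lt D s fun i => a (i + x)
      simp only [hc] at hx
      omega
    | succ k ih =>
      intro x hx h1 h2
      simp only [Nat.add_mul, one_mul] at h1 h2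
      by_cases hr : IsRuler D s fun k => a (k + (x - D))
      · exact ⟨x - D, by omega, hr⟩
      · simp only [IsRuler, not_forall, not_lt] at hr
        obtain ⟨j, hj, hjD, hle⟩ := hr
        have e1 : ∀ i, i + D + (x - D) = i + x := by omega
        have e2 : ∀ i, i + j + (x - D) = i + (x - D + j) := by omega
        simp only [e1, e2] at hle
        have hlt : c x < c (x - D + j) := by
          refine lt_of_le_of_ne hle ?_
          rcases Nat.lt_or_ge x (x - D + j) with h | h
          · exact hne _ _ h (by omega) (by omega)
          · exact (hne _ _ (by omega) (by omega) (by omega)).symm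
        exact ih (x - D + j) (by omega) (by simp only [Nat.add_mul, one_mul]; omega) (by omega)
  -- Starting in the middle leaves room for `8 ^ D` moves of length `D` in either direction.
  refine key (8 ^ D) (8 ^ D * D + D) (by omega) (by simp [Nat.add_mul]) ?_
  have : 2 * 8 ^ D * D = 8 ^ D * D + 8 ^ D * D := by ring
  omega

end ColeVishkin

/-! ### Parents and children in rooted trees -/

namespace RootedTree

variable {T : RootedTree.{0}}

lemma pred_covBy {v : T} (hv : v ≠ ⊥) : Order.pred v ⋖ v :=
  Order.pred_covBy_of_not_isMin (by rwa [isMin_iff_eq_bot])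

lemma pred_eq_of_covBy {v u : T} (h : v ⋖ u) : Order.pred u = v := h.pred_eq

lemma ne_bot_of_covBy {v u : T} (h : v ⋖ u) : u ≠ ⊥ := h.lt.ne_bot

/-- A property that holds at the root and passes from parents to children holds everywhere. -/
lemma induction_top_down {p : T → Prop} (root : p ⊥)
    (child : ∀ v : T, v ≠ ⊥ → p (Order.pred v) → p v) (v : T) : p v := by
  obtain ⟨k, hk⟩ := IsPredArchimedean.exists_pred_iterate_of_le (bot_le : ⊥ ≤ v)
  induction k generalizing v with
  | zero =>
    have : v = ⊥ := hk
    exact this ▸ root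
  | succ k ih =>
    by_cases hv : v = ⊥
    · exact hv ▸ root
    · exact child v hv (ih _ (by rwa [Function.iterate_succ_apply] at hk))

lemma disjoint_Ici_of_covBy {v u w : T} (hu : v ⋖ u) (hw : v ⋖ w) (h : u ≠ w) :
    Disjoint (Set.Ici u) (Set.Ici w) := by
  rw [Set.disjoint_left]
  intro x hxu hxw
  rcases le_total_of_directed hxu hxw with h1 | h1
  · first
    | exact h (h1.eq_or_lt.resolve_right (hw.2 hu.lt))
    | exact h (h1.eq_or_lt.resolve_right (hu.2 hw.lt)).symm
  · first
    | exact h (h1.eq_or_lt.resolve_right (hu.2 hw.lt)).symm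
    | exact h (h1.eq_or_lt.resolve_right (hw.2 hu.lt))

end RootedTree

namespace Network

variable {δ : ℕ} {T : RootedTree.{0}} (N : Network δ T)

open Classical in
/-- The child of `v` attached to its child port `i`, if there is one. -/
noncomputable def childAt (v : T) (i : Fin δ) : Option T :=
  if h : ∃ u, v ⋖ u ∧ N.port u = i then some h.choose else none

lemma childAt_eq_some_iff {v u : T} {i : Fin δ} :
    N.childAt v i = some u ↔ v ⋖ u ∧ N.port u = i := by
  unfold childAt
  split_ifs with h
  · rw [Option.some_inj]
    refine ⟨fun e => e ▸ h.choose_spec, fun e => ?_⟩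
    exact N.port_injective v _ _ h.choose_spec.1 e.1 (h.choose_spec.2.trans e.2.symm)
  · simp only [false_iff]
    exact fun e => h ⟨u, e⟩

lemma childAt_pred {v : T} (hv : v ≠ ⊥) : N.childAt (Order.pred v) (N.port v) = some v :=
  N.childAt_eq_some_iff.2 ⟨RootedTree.pred_covBy hv, rfl⟩

lemma pred_of_childAt {v u : T} {i : Fin δ} (h : N.childAt v i = some u) : Order.pred u = v :=
  RootedTree.pred_eq_of_covBy (N.childAt_eq_some_iff.1 h).1

lemma ne_bot_of_childAt {v u : T} {i : Fin δ} (h : N.childAt v i = some u) : u ≠ ⊥ :=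
  RootedTree.ne_bot_of_covBy (N.childAt_eq_some_iff.1 h).1

/-- The subtrees of the children of `v` are disjoint parts of the subtree of `v`. -/
lemma sum_ncard_Ici_childAt_le [Fintype T] (v : T) :
    ∑ i, (N.childAt v i).elim 0 (fun u => (Set.Ici u).ncard) ≤ (Set.Ici v).ncard := by
  classical
  have h1 : ∀ i, (N.childAt v i).elim 0 (fun u => (Set.Ici u).ncard) =
      ((N.childAt v i).elim ∅ fun u => (Set.Ici u).toFinset).card := by
    intro i
    cases N.childAt v i with
    | none => simp
    | some u => simp [Set.ncard_eq_toFinset_card']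
  rw [Finset.sum_congr rfl fun i _ => h1 i, ← Finset.card_biUnion, Set.ncard_eq_toFinset_card']
  · refine Finset.card_le_card fun x hx => ?_
    simp only [Finset.mem_biUnion, Finset.mem_univ, true_and] at hx
    obtain ⟨i, hi⟩ := hx
    cases h : N.childAt v i with
    | none => simp [h] at hi
    | some u =>
      simp only [h, Option.elim_some, Set.mem_toFinset, Set.mem_Ici] at hi ⊢
      exact (N.childAt_eq_some_iff.1 h).1.le.trans hi
  · intro i _ j _ hij
    rw [Function.onFun]
    cases hi : N.childAt v i with
    | none => simp
    | some u =>
      cases hj : N.childAt v j with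
      | none => simp
      | some w =>
        simp only [Option.elim_some]
        rw [Set.disjoint_toFinset]
        rw [childAt_eq_some_iff] at hi hj
        refine RootedTree.disjoint_Ici_of_covBy hi.1 hj.1 ?_
        rintro rfl
        exact hij (hi.2.symm.trans hj.2)

end Network

/-! ### Programs -/

/-- One round of a distributed algorithm whose messages are natural numbers. -/
structure Instr (δ : ℕ) (S : Type u) where
  send : S → Port δ → ℕ
  update : S → (Port δ → Option ℕ) → S

namespace Network

variable {δ : ℕ} {T : RootedTree.{0}} (N : Network δ T) {S : Type u}

open Classical in
/-- The numbers that `v` receives when each node `u` sends `out u q` through its port `q`. -/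
noncomputable def natInbox (out : T → Port δ → ℕ) (v : T) : Port δ → Option ℕ
  | .parent => if v = ⊥ then none else some (out (Order.pred v) (.child (N.port v)))
  | .child i => (N.childAt v i).map fun u => out u .parent

/-- The effect of one round, where messages are reduced modulo `2 ^ m`. -/
noncomputable def exec (m : ℕ) (I : Instr δ S) (σ : T → S) (v : T) : S :=
  I.update (σ v) (N.natInbox (fun u q => I.send (σ u) q % 2 ^ m) v)

/-- The effect of a list of rounds. -/
noncomputable def run (m : ℕ) (l : List (Instr δ S)) (σ : T → S) : T → S :=
  l.foldl (fun σ I => N.exec m I σ) σ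

lemma run_append (m : ℕ) (l l' : List (Instr δ S)) (σ : T → S) :
    N.run m (l ++ l') σ = N.run m l' (N.run m l σ) := List.foldl_append ..

lemma run_replicate_succ (m t : ℕ) (I : Instr δ S) (σ : T → S) :
    N.run m (List.replicate (t + 1) I) σ = N.exec m I (N.run m (List.replicate t I) σ) := by
  rw [List.replicate_succ', run_append]
  rfl

lemma inbox_bits (out : T → Port δ → ℕ) (v : T) (q : Port δ) :
    (N.inbox (fun u q => (out u q).bits) v q).map (Function.invFun Nat.bits) =
      N.natInbox out v q := by
  have hinv : ∀ x : ℕ, Function.invFun Nat.bits x.bits = x :=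
    Function.leftInverse_invFun fun x y h => Nat.eq_of_testBit_eq fun i => by
      rw [Nat.testBit_eq_inth, Nat.testBit_eq_inth, h]
  cases q with
  | parent =>
    unfold inbox natInbox
    split_ifs <;> simp [hinv]
  | child i =>
    unfold inbox natInbox childAt
    split_ifs <;> simp [hinv]

end Network

/-- The distributed algorithm which, on `n`-node trees, executes the rounds `prog n` on states
given initially by `ini`, with messages reduced modulo `2 ^ m n`. -/
noncomputable def DistAlgorithm.ofProgram {δ : ℕ} {α S : Type u} (prog : ℕ → List (Instr δ S))
    (m : ℕ → ℕ) (ini : NodeInput → S) (out : S → α) : DistAlgorithm δ α where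
  State := List (Instr δ S) × ℕ × S
  init x := (prog x.size, m x.size, ini x)
  send st q :=
    match st with
    | ([], _, _) => []
    | (I :: _, b, s) => (I.send s q % 2 ^ b).bits
  update st inb :=
    match st with
    | ([], b, s) => ([], b, s)
    | (I :: l, b, s) => (l, b, I.update s fun q => (inb q).map (Function.invFun Nat.bits))
  output st := out st.2.2

lemma DistAlgorithm.state_ofProgram {δ : ℕ} {α S : Type u} (prog : ℕ → List (Instr δ S))
    (m : ℕ → ℕ) (ini : NodeInput → S) (out : S → α) {T : RootedTree.{0}} [Fintype T]
    (N : Network δ T) (t : ℕ) (ht : t ≤ (prog (Fintype.card T)).length) (v : T) :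
    (ofProgram prog m ini out).state N t v =
      ((prog (Fintype.card T)).drop t, m (Fintype.card T),
        N.run (m (Fintype.card T)) ((prog (Fintype.card T)).take t)
          (fun u => ini (N.input u)) v) := by
  induction t generalizing v with
  | zero => rfl
  | succ t ih =>
    have ht' : t < (prog (Fintype.card T)).length := ht
    have hstate := funext fun u => ih ht'.le u
    unfold state
    rw [hstate, List.drop_eq_getElem_cons ht', List.take_succ_eq_append_getElem ht',
      Network.run_append]
    simp only [ofProgram, Network.inbox_bits]
    rfl

/-- To solve a problem it suffices to give, for each size, a list of rounds. -/
lemma LCL.solvableInCongest_of_programs {δ : ℕ} {α : Type u} (P : LCL δ α) (f : ℕ → ℝ)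
    (h : ∀ p : Polynomial ℕ, ∃ (S : Type u) (prog : ℕ → List (Instr δ S)) (m : ℕ → ℕ)
      (ini : NodeInput → S) (out : S → α),
      (fun n => ((prog n).length : ℝ)) =O[Filter.atTop] f ∧
      (fun n => (m n : ℝ)) =O[Filter.atTop] (fun n : ℕ => Real.log n) ∧
      ∀ (T : RootedTree.{0}) [Fintype T], T.IsFull δ →
        ∀ N : Network δ T, (∀ v, N.ident v ∈ Finset.Icc 1 (p.eval (Fintype.card T))) →
          P.IsSolution T fun v => out (N.run (m (Fintype.card T)) (prog (Fintype.card T))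
            (fun u => ini (N.input u)) v)) :
    P.SolvableInCongest f := by
  intro p
  obtain ⟨S, prog, m, ini, out, hlen, hm, hsol⟩ := h p
  refine ⟨.ofProgram prog m ini out, fun n => (prog n).length, m, hlen, hm, ?_⟩
  intro T _ hT N hN
  refine ⟨fun t ht v q => ?_, ?_⟩
  · rw [DistAlgorithm.state_ofProgram prog m ini out N t ht.le, List.drop_eq_getElem_cons ht]
    simp only [DistAlgorithm.ofProgram]
    rw [Nat.size_eq_bits_len, Nat.size_le]
    exact Nat.mod_lt _ (by positivity)
  · have := hsol T hT N hN
    simp only [DistAlgorithm.state_ofProgram prog m ini out N _ le_rfl, List.take_length]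
    exact this

namespace Network

variable {δ : ℕ} {T : RootedTree.{0}} (N : Network δ T)

/-! ### Identifiers of ancestors -/

open Classical in
/-- The identifier of the `t`-th ancestor of a node, where the path from the node to the root is
continued beyond the root by virtual nodes with identifiers larger than `M`. -/
noncomputable def ancId (M : ℕ) : ℕ → T → ℕ
  | 0, v => N.ident v
  | t + 1, v => if v = ⊥ then M + t + 1 else ancId M t (Order.pred v)

lemma ancId_succ {M t : ℕ} {v : T} (hv : v ≠ ⊥) :
    N.ancId M (t + 1) v = N.ancId M t (Order.pred v) := by
  rw [ancId, if_neg hv]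

lemma ancId_add {M t e : ℕ} {v : T} (hv : ∀ k < e, Order.pred^[k] v ≠ ⊥) :
    N.ancId M (t + e) v = N.ancId M t (Order.pred^[e] v) := by
  induction e generalizing v with
  | zero => rfl
  | succ e ih =>
    rw [← Nat.add_assoc, N.ancId_succ (v := v) (hv 0 (by omega)), Function.iterate_succ_apply]
    exact ih fun k hk => by simpa using hv (k + 1) (by omega)

lemma ancId_le {M : ℕ} (hM : ∀ v, N.ident v ≤ M) (t : ℕ) (v : T) : N.ancId M t v ≤ M + t := by
  induction t generalizing v with
  | zero => exact hM v
  | succ t ih =>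
    unfold ancId
    split_ifs
    · omega
    · have := ih (Order.pred v)
      omega

lemma lt_ancId_or_eq_ident (M t : ℕ) (v : T) :
    M < N.ancId M t v ∨ ∃ u ≤ v, N.ancId M t v = N.ident u := by
  induction t generalizing v with
  | zero => exact .inr ⟨v, le_rfl, rfl⟩
  | succ t ih =>
    unfold ancId
    split_ifs
    · exact .inl (by omega)
    · exact (ih (Order.pred v)).imp_right fun ⟨u, hu, h⟩ => ⟨u, hu.trans (Order.pred_le v), h⟩

/-- Real ancestors have distinct identifiers up to `M`; virtual ones exceed `M` and increase. The
extension beyond the root spares the coloring any special treatment near the root. -/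
lemma ancId_injective {M : ℕ} (hM : ∀ v, N.ident v ≤ M) (v : T) :
    Function.Injective fun t => N.ancId M t v := by
  suffices h : ∀ (i j : ℕ) (v : T), i < j → N.ancId M i v ≠ N.ancId M j v by
    intro i j hij
    rcases lt_trichotomy i j with h1 | h1 | h1
    · exact absurd hij (h i j v h1)
    · exact h1
    · exact absurd hij.symm (h j i v h1)
  intro i
  induction i with
  | zero =>
    intro j v hj
    obtain ⟨j, rfl⟩ := Nat.exists_eq_succ_of_ne_zero hj.ne'
    by_cases hv : v = ⊥
    · have := hM v
      simp only [ancId, if_pos hv]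
      omega
    · rw [Nat.succ_eq_add_one, N.ancId_succ hv]
      rcases N.lt_ancId_or_eq_ident M j (Order.pred v) with h | ⟨u, hu, h⟩
      · exact ((hM v).trans_lt h).ne
      · rw [h]
        intro h'
        exact (hu.trans_lt (RootedTree.pred_covBy hv).lt).ne (N.ident_injective h').symm
  | succ i ih =>
    intro j v hj
    obtain ⟨j, rfl⟩ := Nat.exists_eq_succ_of_ne_zero (Nat.ne_zero_of_lt hj)
    by_cases hv : v = ⊥
    · simp only [ancId, if_pos hv]
      omega
    · rw [Nat.succ_eq_add_one, N.ancId_succ hv, N.ancId_succ hv]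
      exact ih j _ (by omega)

/-! ### Raking and compressing

The nodes in a set `Y` cut the tree into clusters. A node of `Y` stays alive as long as there are at
least two nodes of `Y` right below its cluster that are alive. -/

open Classical in
/-- What a node with the given count, in `Y` iff `y` holds, contributes to the count of its
parent. -/
noncomputable def signal (y : Prop) (c : ℕ) : ℕ := if y then (if 2 ≤ c then 1 else 0) else c

/-- The number, capped at `2`, of alive nodes of `Y` seen by `v` after `t` rounds. -/
noncomputable def count (Y : T → Prop) : ℕ → T → ℕ
  | 0, _ => 2
  | t + 1, v => min 2 (∑ i, (N.childAt v i).elim 0 fun u => signal (Y u) (count Y t u))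

open Classical in
/-- Some index at which `f` does not vanish. -/
noncomputable def pick (f : Fin δ → ℕ) : Option (Fin δ) :=
  if h : ∃ i, 1 ≤ f i then some h.choose else none

lemma pick_eq_some {f : Fin δ → ℕ} (hf : ∑ i, f i < 2) {i : Fin δ} (hi : 1 ≤ f i) :
    pick f = some i := by
  have h : ∃ i, 1 ≤ f i := ⟨i, hi⟩
  rw [pick, dif_pos h, Option.some_inj]
  by_contra hne
  have h1 := Finset.add_le_sum (f := f) (fun _ _ => Nat.zero_le _) (Finset.mem_univ h.choose)
    (Finset.mem_univ i) hne
  have h2 := h.choose_spec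
  omega

open Classical in
/-- The port to the only child that contributed to the count of `v` when it dropped below `2`. -/
noncomputable def pointer (Y : T → Prop) : ℕ → T → Option (Fin δ)
  | 0, _ => none
  | t + 1, v =>
    if 2 ≤ N.count Y t v then
      pick fun i => (N.childAt v i).elim 0 fun u => signal (Y u) (N.count Y t u)
    else pointer Y t v

variable {Y : T → Prop}

lemma count_le_two (t : ℕ) (v : T) : N.count Y t v ≤ 2 := by
  cases t with
  | zero => exact le_rfl
  | succ t => exact min_le_left _ _

lemma signal_mono {y : Prop} {c c' : ℕ} (h : c ≤ c') : signal y c ≤ signal y c' := by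
  unfold signal
  split_ifs <;> omega

lemma signal_of_not {y : Prop} (h : ¬ y) (c : ℕ) : signal y c = c := if_neg h

lemma lt_two_of_signal_eq_zero {y : Prop} {c : ℕ} (h : signal y c = 0) : c < 2 := by
  unfold signal at h
  split_ifs at h <;> omega

lemma count_succ_le (t : ℕ) (v : T) : N.count Y (t + 1) v ≤ N.count Y t v := by
  induction t generalizing v with
  | zero => exact N.count_le_two 1 v
  | succ t ih =>
    rw [count, count]
    refine min_le_min_left _ (Finset.sum_le_sum fun i _ => ?_)
    cases N.childAt v i with
    | none => exact le_rfl
    | some u => exact signal_mono (ih u)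

lemma count_antitone (v : T) : Antitone fun t => N.count Y t v :=
  antitone_nat_of_succ_le fun t => N.count_succ_le t v

lemma signal_le_count {t : ℕ} {u : T} (hu : u ≠ ⊥) (h : N.count Y (t + 1) (Order.pred u) < 2) :
    signal (Y u) (N.count Y t u) ≤ N.count Y (t + 1) (Order.pred u) := by
  rw [count] at h ⊢
  have h1 := Finset.single_le_sum
    (f := fun i => (N.childAt (Order.pred u) i).elim 0 fun u => signal (Y u) (N.count Y t u))
    (fun _ _ => Nat.zero_le _) (Finset.mem_univ (N.port u))
  simp only [N.childAt_pred hu, Option.elim_some] at h1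
  omega

-- Here `ρ` is the distance up to the nearest node of `Y` or the root. Going down to a child outside
-- `Y` trades one round for one unit of `ρ`. Going down to an alive child in `Y` resets `ρ` to 0 and
-- raises the exponent by at most one, which is paid for because a count of 2 is passed on as 1.
open Classical in
lemma count_mul_two_pow_le [Fintype T] {R : ℕ}
    (hR : ∀ v, ∃ i < R, Y (Order.pred^[i] v) ∨ Order.pred^[i] v = ⊥) (t : ℕ) (v : T)
    (ρ : ℕ) (hρ : ρ < R) (hY : Y (Order.pred^[ρ] v) ∨ Order.pred^[ρ] v = ⊥)
    (hmin : ∀ i < ρ, ¬ (Y (Order.pred^[i] v) ∨ Order.pred^[i] v = ⊥)) :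
    N.count Y t v * 2 ^ ((t + ρ) / R) ≤ 2 * (Set.Ici v).ncard := by
  induction t generalizing v ρ with
  | zero =>
    rw [Nat.zero_add, Nat.div_eq_of_lt hρ, count]
    have : 0 < (Set.Ici v).ncard := (Set.ncard_pos).2 ⟨v, Set.mem_Ici.2 le_rfl⟩
    omega
  | succ t ih =>
    refine le_trans ?_ (Nat.mul_le_mul_left 2 (N.sum_ncard_Ici_childAt_le v))
    rw [count, Finset.mul_sum]
    refine (Nat.mul_le_mul_right _ (min_le_right _ _)).trans ?_
    rw [Finset.sum_mul]
    refine Finset.sum_le_sum fun i _ => ?_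
    cases h : N.childAt v i with
    | none => simp
    | some u =>
      have hu := N.ne_bot_of_childAt h
      have huv := N.pred_of_childAt h
      simp only [Option.elim_some]
      by_cases hYu : Y u
      · have h0 := ih u 0 (by omega) (.inl hYu) (by omega)
        rw [signal, if_pos hYu]
        split_ifs with hc
        · have h2 := N.count_le_two (Y := Y) t u
          have hpow : 2 ^ ((t + 1 + ρ) / R) ≤ 2 ^ ((t + 0) / R + 1) := by
            refine Nat.pow_le_pow_right (by norm_num) ?_
            rw [← Nat.add_div_right _ (by omega : 0 < R)]
            exact Nat.div_le_div_right (by omega)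
          rw [pow_succ] at hpow
          have h3 : N.count Y t u = 2 := by omega
          rw [h3] at h0
          omega
        · simp
      · rw [signal_of_not hYu]
        obtain ⟨i, hi, hYi⟩ := hR u
        have hmin' : ∀ i < ρ + 1, ¬ (Y (Order.pred^[i] u) ∨ Order.pred^[i] u = ⊥) := by
          intro i hi
          cases i with
          | zero => simpa using ⟨hYu, hu⟩
          | succ i =>
            rw [Function.iterate_succ_apply, huv]
            exact hmin i (by omega)
        have hρi : ρ + 1 ≤ i := by
          by_contra! hlt
          exact hmin' i hlt hYi
        have := ih u (ρ + 1) (by omega) (by rwa [Function.iterate_succ_apply, huv]) hmin'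
        rwa [show t + 1 + ρ = t + (ρ + 1) by omega]

open Classical in
lemma count_lt_two [Fintype T] {R : ℕ}
    (hR : ∀ v, ∃ i < R, Y (Order.pred^[i] v) ∨ Order.pred^[i] v = ⊥) (v : T) :
    N.count Y (R * (Nat.log 2 (Fintype.card T) + 1)) v < 2 := by
  by_contra! h
  have hv := hR v
  have hspec := Nat.find_spec hv
  have h1 := N.count_mul_two_pow_le hR (R * (Nat.log 2 (Fintype.card T) + 1)) v (Nat.find hv)
    hspec.1 hspec.2 (fun i hi hYi => Nat.find_min hv hi ⟨hi.trans hspec.1, hYi⟩)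
  have hpow : 2 ^ (Nat.log 2 (Fintype.card T) + 1) ≤
      2 ^ ((R * (Nat.log 2 (Fintype.card T) + 1) + Nat.find hv) / R) := by
    refine Nat.pow_le_pow_right (by norm_num) ?_
    rw [Nat.le_div_iff_mul_le (by omega), Nat.mul_comm]
    omega
  have hlog := Nat.lt_pow_succ_log_self (b := 2) (by norm_num) (Fintype.card T)
  have hcard : (Set.Ici v).ncard ≤ Fintype.card T := by
    rw [← Nat.card_eq_fintype_card]
    exact Set.ncard_le_card _
  have := Nat.mul_le_mul_right (2 ^ ((R * (Nat.log 2 (Fintype.card T) + 1) + Nat.find hv) / R)) h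
  omega

/-- The first round after which the count of `v` is below `2`. -/
noncomputable def settle (Y : T → Prop) (v : T) : ℕ := sInf {t | N.count Y t v < 2}

lemma settle_le {t : ℕ} {v : T} (h : N.count Y t v < 2) : N.settle Y v ≤ t := Nat.sInf_le h

/-- A zero count means that all children contributed zero one round earlier, so zeros can be traced
downwards, each edge costing a round. At the lowest node, possibly in `Y`, a zero signal still means
a count below 2. -/
lemma settle_add_le_of_signal_eq_zero {v : T} {i t : ℕ}
    (hbot : ∀ k < i, Order.pred^[k] v ≠ ⊥)
    (hY : ∀ k, 0 < k → k ≤ i → ¬ Y (Order.pred^[k] v))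
    (h : signal (Y (Order.pred^[i] v)) (N.count Y t (Order.pred^[i] v)) = 0) :
    N.settle Y v + i ≤ t := by
  induction i generalizing t with
  | zero =>
    exact N.settle_le (v := v) (lt_two_of_signal_eq_zero h)
  | succ i ih =>
    rw [signal_of_not (hY (i + 1) (by omega) le_rfl), Function.iterate_succ_apply'] at h
    cases t with
    | zero => simp [count] at h
    | succ t =>
      have h1 := N.signal_le_count (hbot i (by omega)) (lt_of_eq_of_lt h two_pos)
      have := ih (fun k hk => hbot k (by omega)) (fun k hk hki => hY k hk (by omega)) (t := t)
        (by omega)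
      omega

section Settle

variable {H : ℕ} (hH : ∀ v, N.count Y H v < 2)

include hH

lemma count_settle (v : T) : N.count Y (N.settle Y v) v < 2 :=
  Nat.sInf_mem (s := {t | N.count Y t v < 2}) ⟨H, hH v⟩

lemma exists_settle_eq (v : T) : ∃ t, N.settle Y v = t + 1 := by
  refine Nat.exists_eq_succ_of_ne_zero fun h => ?_
  have := N.count_settle hH v
  rw [h, count] at this
  omega

lemma pointer_eq {t : ℕ} {v : T} (ht : N.settle Y v = t + 1) :
    N.pointer Y H v =
      pick fun i => (N.childAt v i).elim 0 fun u => signal (Y u) (N.count Y t u) := by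
  have hlt := N.count_settle hH v
  have hle : t + 1 ≤ H := ht ▸ N.settle_le (hH v)
  clear hH
  induction H, hle using Nat.le_induction with
  | base =>
    rw [pointer, if_pos]
    by_contra! h
    have := N.settle_le h
    omega
  | succ k hk ih =>
    have := (N.count_antitone v hk).trans_lt (ht ▸ hlt)
    rw [pointer, if_neg (by simpa using this), ih]

lemma settle_lt_settle_pred {u : T} (hu : u ≠ ⊥) (hY : ¬ Y u) :
    N.settle Y u < N.settle Y (Order.pred u) := by
  obtain ⟨t, ht⟩ := N.exists_settle_eq hH (Order.pred u)
  have h := N.count_settle hH (Order.pred u)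
  rw [ht] at h ⊢
  have h1 := N.signal_le_count hu h
  rw [signal_of_not hY] at h1
  exact Nat.lt_succ_of_le (N.settle_le (h1.trans_lt h))

/-- A child that is not pointed to contributed zero when its parent settled. This is how settling
times grow across a node of `Y`, where `settle_lt_settle_pred` fails. -/
lemma settle_add_le_of_pointer_ne {v : T} {i : ℕ} (hbot : ∀ k ≤ i, Order.pred^[k] v ≠ ⊥)
    (hY : ∀ k, 0 < k → k ≤ i → ¬ Y (Order.pred^[k] v))
    (h : N.pointer Y H (Order.pred^[i + 1] v) ≠ some (N.port (Order.pred^[i] v))) :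
    N.settle Y v + i + 1 ≤ N.settle Y (Order.pred^[i + 1] v) := by
  obtain ⟨t, ht⟩ := N.exists_settle_eq hH (Order.pred^[i + 1] v)
  have hc := N.count_settle hH (Order.pred^[i + 1] v)
  rw [N.pointer_eq hH ht] at h
  rw [ht] at hc
  suffices hs : signal (Y (Order.pred^[i] v)) (N.count Y t (Order.pred^[i] v)) = 0 by
    rw [ht, Nat.succ_le_succ_iff]
    exact N.settle_add_le_of_signal_eq_zero (fun k hk => hbot k hk.le) hY hs
  by_contra hne
  have hsum : ∑ i', (N.childAt (Order.pred^[i + 1] v) i').elim 0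
      (fun u => signal (Y u) (N.count Y t u)) < 2 := by
    rw [count] at hc
    omega
  refine h (pick_eq_some hsum ?_)
  rw [Function.iterate_succ_apply', N.childAt_pred (hbot i le_rfl)]
  exact Nat.one_le_iff_ne_zero.2 hne

end Settle

/-! ### Anchors -/

/-- The last `k` edges on the path from the root to `v` follow the pointers `ptr`. -/
def OnTrack (ptr : T → Option (Fin δ)) : ℕ → T → Prop
  | 0, _ => True
  | k + 1, v => v ≠ ⊥ ∧ ptr (Order.pred v) = some (N.port v) ∧ OnTrack ptr k (Order.pred v)

lemma onTrack_iff {ptr : T → Option (Fin δ)} {k : ℕ} {v : T} :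
    N.OnTrack ptr k v ↔ ∀ i < k, Order.pred^[i] v ≠ ⊥ ∧
      ptr (Order.pred^[i + 1] v) = some (N.port (Order.pred^[i] v)) := by
  induction k generalizing v with
  | zero => simp [OnTrack]
  | succ k ih =>
    rw [OnTrack, ih]
    constructor
    · rintro ⟨h1, h2, h3⟩ i hi
      cases i with
      | zero => exact ⟨h1, h2⟩
      | succ i => exact h3 i (by omega)
    · exact fun h => ⟨(h 0 (by omega)).1, (h 0 (by omega)).2, fun i hi => h (i + 1) (by omega)⟩

/-- Any long enough path towards the root meets the root or a node of `Y` above which there is a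
path of `D` edges that follow the pointers. -/
lemma exists_anchor_above {H D : ℕ} (hH : ∀ v, N.count Y H v < 2)
    (hspace : ∀ (y : T) (e : ℕ), Y y → 0 < e → e ≤ D → (∀ k < e, Order.pred^[k] y ≠ ⊥) →
      ¬ Y (Order.pred^[e] y)) (v : T) :
    ∃ i ≤ H + 1 + D, Order.pred^[i] v = ⊥ ∨
      (Y (Order.pred^[i] v) ∧ N.OnTrack (N.pointer Y H) D (Order.pred^[i] v)) := by
  by_contra! hcon
  have hadd : ∀ i j, Order.pred^[i] (Order.pred^[j] v) = Order.pred^[j + i] v := fun i j => by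
    rw [Nat.add_comm, Function.iterate_add_apply]
  -- The settling time keeps pace with the height: a node outside `Y` gains one per edge, and a
  -- non-anchor in `Y` gains as many as the edges up to its first-found deviation from the pointers.
  -- Such a jump may overshoot `m` by up to `D`.
  have key : ∀ m ≤ H + 1, ∃ j, m ≤ j ∧ j ≤ m + D ∧ j ≤ N.settle Y (Order.pred^[j] v) := by
    intro m
    induction m with
    | zero => exact fun _ => ⟨0, by omega, by omega, by omega⟩
    | succ m ih =>
      intro hm
      obtain ⟨j, h1, h2, h3⟩ := ih (by omega)
      rcases h1.lt_or_eq with hlt | rfl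
      · exact ⟨j, by omega, by omega, h3⟩
      · by_cases hY : Y (Order.pred^[m] v)
        · have htrack := (hcon m (by omega)).2 hY
          rw [onTrack_iff] at htrack
          push Not at htrack
          obtain ⟨i, hi, hptr⟩ := htrack
          have hbot : ∀ k ≤ i, Order.pred^[k] (Order.pred^[m] v) ≠ ⊥ := fun k hk => by
            rw [hadd]
            exact (hcon _ (by omega)).1
          have := N.settle_add_le_of_pointer_ne hH hbot
            (fun k hk hki => hspace _ k hY hk (by omega) fun l hl => hbot l (by omega))
            (hptr (hbot i le_rfl))
          rw [hadd] at this
          exact ⟨m + (i + 1), by omega, by omega, by omega⟩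
        · have := N.settle_lt_settle_pred hH (hcon m (by omega)).1 hY
          rw [← Function.iterate_succ_apply' Order.pred] at this
          refine ⟨m + 1, le_rfl, ?_, by simp only [Nat.succ_eq_add_one] at this; omega⟩
          by_contra hD
          omega
  obtain ⟨j, h1, _, h3⟩ := key (H + 1) le_rfl
  have := N.settle_le (hH (Order.pred^[j] v))
  omega

/-- The number of steps from a node to the first node in `A` along the pointers `ptr`, where at
least the nodes with at most `k - 1` steps are determined, and all others have the value
`K + 1`. -/
noncomputable def pointerDist (ptr : T → Option (Fin δ)) (A : T → Prop) (K : ℕ) : ℕ → T → ℕ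
  | 0, _ => K + 1
  | k + 1, v =>
    open Classical in if A v then 0 else
      (ptr v).elim (K + 1) fun i =>
        min (K + 1) ((N.childAt v i).elim (K + 1) (pointerDist ptr A K k) + 1)

section PointerDist

variable {ptr : T → Option (Fin δ)} {A : T → Prop} {K : ℕ}

lemma pointerDist_le (k : ℕ) (v : T) : N.pointerDist ptr A K k v ≤ K + 1 := by
  cases k with
  | zero => exact le_rfl
  | succ k =>
    rw [pointerDist]
    split_ifs
    · omega
    · cases ptr v with
      | none => exact le_rfl
      | some i => exact min_le_left _ _

/-- A value first found in iteration `k + 1` is exactly `k`. Hence iteration `K + 2` could only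
produce the cap `K + 1` again. -/
lemma pointerDist_succ_eq_or (k : ℕ) (v : T) :
    N.pointerDist ptr A K (k + 1) v = N.pointerDist ptr A K k v ∨
      N.pointerDist ptr A K k v = K + 1 ∧ N.pointerDist ptr A K (k + 1) v = k := by
  induction k generalizing v with
  | zero =>
    rw [pointerDist, pointerDist]
    split_ifs
    · exact .inr ⟨rfl, rfl⟩
    · refine .inl ?_
      cases ptr v with
      | none => rfl
      | some i =>
        cases h : N.childAt v i with
        | none => simp [h]
        | some u => simp [h, pointerDist]
  | succ k ih =>
    rw [pointerDist, pointerDist]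
    split_ifs
    · exact .inl rfl
    · cases ptr v with
      | none => exact .inl rfl
      | some i =>
        cases h : N.childAt v i with
        | none => exact .inl (by simp [h])
        | some u =>
          simp only [h, Option.elim_some]
          rcases ih u with h1 | ⟨h1, h2⟩
          · exact .inl (by rw [h1])
          · rw [h1, h2]
            omega

lemma pointerDist_fixed (v : T) :
    N.pointerDist ptr A K (K + 2) v = N.pointerDist ptr A K (K + 1) v := by
  rcases N.pointerDist_succ_eq_or (ptr := ptr) (A := A) (K := K) (K + 1) v with h | ⟨h1, h2⟩
  · exact h
  · rw [h1, h2]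

lemma exists_of_pointerDist_le {k : ℕ} {v : T} (h : N.pointerDist ptr A K k v ≤ K) :
    ∃ y, Order.pred^[N.pointerDist ptr A K k v] y = v ∧ A y := by
  induction k generalizing v with
  | zero => simp [pointerDist] at h
  | succ k ih =>
    rw [pointerDist] at h ⊢
    split_ifs at h ⊢ with hA
    · exact ⟨v, rfl, hA⟩
    · cases hp : ptr v with
      | none => simp [hp] at h
      | some i =>
        cases hc : N.childAt v i with
        | none => simp [hp, hc] at h
        | some u =>
          simp only [hp, hc, Option.elim_some] at h ⊢
          obtain ⟨y, hy, hAy⟩ := ih (v := u) (by omega)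
          refine ⟨y, ?_, hAy⟩
          rw [min_eq_right (by omega), Function.iterate_succ_apply', hy, N.pred_of_childAt hc]

end PointerDist

end Network

/-! ### Absorbing subproblems -/

namespace LCL

variable {δ : ℕ} {α : Type u} {P Q : LCL δ α}

lemma transition_iff {a b : α} :
    P.Transition a b ↔ ∃ c ∈ P.configs, c.1 = a ∧ ∃ i, c.2 i = b := Iff.rfl

lemma Transition.mem_labels {a b : α} (h : P.Transition a b) : b ∈ P.labels := by
  obtain ⟨c, hc, -, i, rfl⟩ := transition_iff.1 h
  exact (P.mem_labels c hc).2 i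

lemma hasWalk_add {i j : ℕ} {a b : α} :
    P.HasWalk (i + j) a b ↔ ∃ c, P.HasWalk i a c ∧ P.HasWalk j c b := by
  induction i generalizing a with
  | zero => simp [HasWalk]
  | succ i ih =>
    rw [Nat.succ_add]
    simp only [HasWalk, ih]
    constructor
    · rintro ⟨c, h1, e, h2, h3⟩
      exact ⟨e, ⟨c, h1, h2⟩, h3⟩
    · rintro ⟨e, ⟨c, h1, h2⟩, h3⟩
      exact ⟨c, h1, e, h2, h3⟩

lemma HasWalk.mem_labels {k : ℕ} {a b : α} (h : P.HasWalk k a b) (ha : a ∈ P.labels) :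
    b ∈ P.labels := by
  induction k generalizing a with
  | zero =>
    have h' : a = b := h
    exact h' ▸ ha
  | succ k ih =>
    obtain ⟨c, hc, h⟩ := h
    exact ih h hc.mem_labels

lemma labels_pruned_subset (i : ℕ) : (P.pruned i).labels ⊆ P.labels := by
  induction i with
  | zero => exact subset_rfl
  | succ i ih =>
    rw [pruned, Function.iterate_succ_apply']
    exact Set.inter_subset_left.trans ih

lemma configs_pruned_subset (i : ℕ) : (P.pruned i).configs ⊆ P.configs := by
  induction i with
  | zero => exact subset_rfl
  | succ i ih =>
    rw [pruned, Function.iterate_succ_apply']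
    exact fun c hc => ih hc.1

lemma HasLogCertificate.exists_pathFlexible (hP : P.HasLogCertificate) :
    ∃ Q : LCL δ α, Q.labels.Nonempty ∧ Q.labels ⊆ P.labels ∧ Q.configs ⊆ P.configs ∧
      ∀ a ∈ Q.labels, Q.PathFlexible a := by
  obtain ⟨i, hfix, hne⟩ := hP
  refine ⟨P.pruned i, hne, labels_pruned_subset i, configs_pruned_subset i, fun a ha => ?_⟩
  rw [← hfix, pruned, Function.iterate_succ_apply'] at ha
  exact ha.2

/-- There is a label which can be reached from every label that it reaches. -/
lemma exists_recurrent (hne : P.labels.Nonempty) :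
    ∃ s ∈ P.labels, ∀ b k, P.HasWalk k s b → ∃ l, P.HasWalk l b s := by
  let reach : α → Set α := fun a => {b | ∃ k, P.HasWalk k a b}
  have hfin : ∀ a ∈ P.labels, (reach a).Finite := fun a ha =>
    P.finite_labels.subset fun b ⟨k, hk⟩ => hk.mem_labels ha
  -- Take a label reaching the fewest labels. Whatever it reaches has a smaller or equal reach,
  -- hence by minimality the same one, which contains `s`.
  obtain ⟨s, hs, hmin⟩ := Set.exists_min_image P.labels (fun a => (reach a).ncard)
    P.finite_labels hne
  refine ⟨s, hs, fun b k hk => ?_⟩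
  have hsub : reach b ⊆ reach s := fun c ⟨l, hl⟩ => ⟨k + l, hasWalk_add.2 ⟨b, hk, hl⟩⟩
  have heq := Set.eq_of_subset_of_ncard_le hsub (hmin b (hk.mem_labels hs)) (hfin s hs)
  have hmem : s ∈ reach s := ⟨0, rfl⟩
  rw [← heq] at hmem
  exact hmem

lemma HasLogCertificate.exists_absorbing (hP : P.HasLogCertificate) :
    ∃ (Q : LCL δ α) (s : α) (K : ℕ), s ∈ Q.labels ∧ Q.labels ⊆ P.labels ∧
      Q.configs ⊆ P.configs ∧ (∀ a ∈ Q.labels, ∃ c ∈ Q.configs, c.1 = a) ∧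
      ∀ a ∈ Q.labels, Q.HasWalk K a s := by
  obtain ⟨Q, hne, hlab, hcfg, hflex⟩ := hP.exists_pathFlexible
  obtain ⟨s, hs, hrec⟩ := exists_recurrent hne
  let S : Set α := {b | ∃ k, Q.HasWalk k s b}
  have hclosed : ∀ c ∈ Q.configs, c.1 ∈ S → ∀ i, c.2 i ∈ S := by
    rintro c hc ⟨k, hk⟩ i
    exact ⟨k + 1, hasWalk_add.2 ⟨c.1, hk, c.2 i, ⟨c, hc, rfl, i, rfl⟩, rfl⟩⟩
  have hwalk : ∀ k a b, a ∈ S → Q.HasWalk k a b → (Q.restrict S).HasWalk k a b := by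
    intro k
    induction k with
    | zero => exact fun a b _ h => h
    | succ k ih =>
      rintro a b ha ⟨e, ⟨c, hc, rfl, i, rfl⟩, h⟩
      exact ⟨c.2 i, ⟨c, ⟨hc, ha, hclosed c hc ha⟩, rfl, i, rfl⟩, ih _ b (hclosed c hc ha i) h⟩
  -- Walk to `s` once, then use the flexibility of `s` to pad the walk to any large length.
  -- Finiteness makes the bound uniform.
  have hbound : ∀ a : α, ∃ K, a ∈ S → ∀ k, K ≤ k → Q.HasWalk k a s := by
    intro a
    by_cases ha : a ∈ S
    · obtain ⟨k, hk⟩ := ha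
      obtain ⟨l, hl⟩ := hrec a k hk
      obtain ⟨-, K, hK⟩ := hflex s hs
      refine ⟨l + K, fun _ m hm => ?_⟩
      rw [show m = l + (m - l) by omega]
      exact hasWalk_add.2 ⟨s, hl, hK _ (by omega)⟩
    · exact ⟨0, fun h => absurd h ha⟩
  choose K hK using hbound
  refine ⟨Q.restrict S, s, Q.finite_labels.toFinset.sup K, ⟨hs, 0, rfl⟩,
    Set.inter_subset_left.trans hlab, fun c hc => hcfg hc.1, ?_, ?_⟩
  · rintro a ⟨ha, haS⟩
    obtain ⟨-, k, hk⟩ := hflex a ha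
    obtain ⟨_, ⟨c, hc, rfl, -⟩, -⟩ := hk (k + 1) (by omega)
    exact ⟨c, ⟨hc, haS, hclosed c hc haS⟩, rfl⟩
  · rintro a ⟨ha, haS⟩
    exact hwalk _ a s haS (hK a haS _ (Finset.le_sup (by simpa using ha)))

/-- A node with label `a` can label its children such that the label of a prescribed child is the
next one on a walk to `s`. -/
lemma exists_assign {s : α} (hs : s ∈ Q.labels) (hcfg : ∀ a ∈ Q.labels, ∃ c ∈ Q.configs, c.1 = a) :
    ∃ assign : α → ℕ → Option (Fin δ) → Fin δ → α,
      (∀ a d p i, assign a d p i ∈ Q.labels) ∧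
      ∀ a ∈ Q.labels, ∀ d p, (∃ ρ : Equiv.Perm (Fin δ),
          (a, fun i => assign a d p (ρ i)) ∈ Q.configs) ∧
        ∀ k i, d = k + 1 → p = some i → Q.HasWalk (k + 1) a s →
          Q.HasWalk k (assign a d p i) s := by
  have key : ∀ (a : α) (d : ℕ) (p : Option (Fin δ)), ∃ f : Fin δ → α, (∀ i, f i ∈ Q.labels) ∧
      (a ∈ Q.labels → (∃ ρ : Equiv.Perm (Fin δ), (a, fun i => f (ρ i)) ∈ Q.configs) ∧
        ∀ k i, d = k + 1 → p = some i → Q.HasWalk (k + 1) a s → Q.HasWalk k (f i) s) := by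
    intro a d p
    by_cases ha : a ∈ Q.labels
    · by_cases hwalk : ∃ k i, d = k + 1 ∧ p = some i ∧ Q.HasWalk (k + 1) a s
      · obtain ⟨k, i, rfl, rfl, _, ⟨c, hc, rfl, j, rfl⟩, hw⟩ := hwalk
        -- The successor on the walk sits at index `j` of the configuration; the swap moves it to
        -- the prescribed port `i`.
        refine ⟨fun x => c.2 (Equiv.swap i j x), fun x => (Q.mem_labels c hc).2 _,
          fun _ => ⟨⟨Equiv.swap i j, by simpa using hc⟩, ?_⟩⟩
        intro k' i' hk hi _
        obtain rfl : k = k' := by omega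
        obtain rfl : i = i' := by simpa using hi
        simpa using hw
      · obtain ⟨c, hc, rfl⟩ := hcfg a ha
        exact ⟨c.2, (Q.mem_labels c hc).2, fun _ => ⟨⟨1, hc⟩, fun k i h1 h2 h3 =>
          absurd ⟨k, i, h1, h2, h3⟩ hwalk⟩⟩
    · exact ⟨fun _ => s, fun _ => hs, fun h => absurd h ha⟩
  choose f hf hf' using key
  exact ⟨f, hf, fun a ha d p => hf' a d p ha⟩

/-- Cut a closed walk of length `K` at `s` when `d` steps remain. -/
lemma exists_start {s : α} {K : ℕ} (hs : s ∈ Q.labels) (hK : ∀ a ∈ Q.labels, Q.HasWalk K a s) :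
    ∃ start : ℕ → α, ∀ d, start d ∈ Q.labels ∧ (d ≤ K → Q.HasWalk d (start d) s) := by
  have key : ∀ d, ∃ a ∈ Q.labels, d ≤ K → Q.HasWalk d a s := by
    intro d
    by_cases hd : d ≤ K
    · have h := hK s hs
      rw [show K = K - d + d by omega, hasWalk_add] at h
      obtain ⟨a, h1, h2⟩ := h
      exact ⟨a, h1.mem_labels hs, fun _ => h2⟩
    · exact ⟨s, hs, fun h => absurd h hd⟩
  choose start h1 h2 using key
  exact ⟨start, fun d => ⟨h1 d, h2 d⟩⟩

end LCL

/-! ### Labeling from the anchors downwards -/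

namespace Network

variable {δ : ℕ} {T : RootedTree.{0}} (N : Network δ T) {α : Type u}

open Classical in
/-- The labels after `t` rounds, in each of which the nodes outside `A` adopt the labels that their
parents assign to them. -/
noncomputable def labelAt (A : T → Prop) (d : T → ℕ) (ptr : T → Option (Fin δ)) (s : α)
    (start : ℕ → α) (assign : α → ℕ → Option (Fin δ) → Fin δ → α) : ℕ → T → α
  | 0, _ => s
  | t + 1, v =>
    if A v then s else
      if v = ⊥ then start (d v) else
        assign (labelAt A d ptr s start assign t (Order.pred v)) (d (Order.pred v))
          (ptr (Order.pred v)) (N.port v)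

variable {A : T → Prop} {d : T → ℕ} {ptr : T → Option (Fin δ)} {s : α} {start : ℕ → α}
  {assign : α → ℕ → Option (Fin δ) → Fin δ → α}

/-- A label depends only on the path up to the nearest anchor or the root, so it is final once
information has come down from there. -/
lemma labelAt_succ_eq {i t : ℕ} {v : T} (h : Order.pred^[i] v = ⊥ ∨ A (Order.pred^[i] v))
    (hit : i < t) :
    N.labelAt A d ptr s start assign (t + 1) v = N.labelAt A d ptr s start assign t v := by
  induction t generalizing v i with
  | zero => omega
  | succ t ih =>
    rw [labelAt]
    split_ifs with hA hv
    · rw [labelAt, if_pos hA]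
    · rw [labelAt, if_neg hA, if_pos hv]
    · cases i with
      | zero =>
        rcases h with h | h
        · exact absurd h hv
        · exact absurd h hA
      | succ i =>
        rw [ih (v := Order.pred v) (i := i) h (by omega)]
        conv_rhs => rw [labelAt, if_neg hA, if_neg hv]

/-- A labeling that is stable under the rule of `labelAt` solves the problem. -/
lemma isSolution_of_stable {P Q : LCL δ α} {K : ℕ} {lab : T → α}
    (hlabels : Q.labels ⊆ P.labels) (hconfigs : Q.configs ⊆ P.configs) (hs : s ∈ Q.labels)
    (hK : ∀ a ∈ Q.labels, Q.HasWalk K a s)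
    (hstart : ∀ d, start d ∈ Q.labels ∧ (d ≤ K → Q.HasWalk d (start d) s))
    (hmem : ∀ a d p i, assign a d p i ∈ Q.labels)
    (hassign : ∀ a ∈ Q.labels, ∀ d p, (∃ ρ : Equiv.Perm (Fin δ),
          (a, fun i => assign a d p (ρ i)) ∈ Q.configs) ∧
        ∀ k i, d = k + 1 → p = some i → Q.HasWalk (k + 1) a s →
          Q.HasWalk k (assign a d p i) s)
    (hA : ∀ v, A v → d v = 0)
    (hd : ∀ u : T, u ≠ ⊥ → d u < K →
      ptr (Order.pred u) = some (N.port u) ∧ d (Order.pred u) = d u + 1)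
    (hlabA : ∀ v, A v → lab v = s) (hroot : ¬ A ⊥ → lab ⊥ = start (d ⊥))
    (hchild : ∀ u : T, u ≠ ⊥ → ¬ A u →
      lab u = assign (lab (Order.pred u)) (d (Order.pred u)) (ptr (Order.pred u)) (N.port u)) :
    P.IsSolution T lab := by
  have hstep : ∀ u : T, u ≠ ⊥ → lab (Order.pred u) ∈ Q.labels →
      (d (Order.pred u) ≤ K → Q.HasWalk (d (Order.pred u)) (lab (Order.pred u)) s) →
      d u ≤ K → Q.HasWalk (d u)
        (assign (lab (Order.pred u)) (d (Order.pred u)) (ptr (Order.pred u)) (N.port u)) s := by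
    intro u hu h1 h2 h3
    rcases h3.lt_or_eq with h | h
    · obtain ⟨hp, hdu⟩ := hd u hu h
      exact (hassign _ h1 _ _).2 _ _ hdu hp (hdu ▸ h2 (by omega))
    · rw [h]
      exact hK _ (hmem _ _ _ _)
  have hinv : ∀ v, lab v ∈ Q.labels ∧ (d v ≤ K → Q.HasWalk (d v) (lab v) s) := by
    refine RootedTree.induction_top_down ?_ fun v hv ih => ?_
    · by_cases h : A ⊥
      · rw [hlabA _ h, hA _ h]
        exact ⟨hs, fun _ => rfl⟩
      · rw [hroot h]
        exact hstart _
    · by_cases h : A v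
      · rw [hlabA _ h, hA _ h]
        exact ⟨hs, fun _ => rfl⟩
      · rw [hchild v hv h]
        exact ⟨hmem _ _ _ _, hstep v hv ih.1 ih.2⟩
  -- Anchors obey their parents too: the assigned label has a walk of length 0 to `s`, so it is `s`.
  have hall : ∀ u : T, u ≠ ⊥ →
      lab u = assign (lab (Order.pred u)) (d (Order.pred u)) (ptr (Order.pred u)) (N.port u) := by
    intro u hu
    by_cases h : A u
    · have := hstep u hu (hinv _).1 (hinv _).2 (by rw [hA u h]; omega)
      rw [hA u h] at this
      rw [hlabA u h]
      exact this.symm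
    · exact hchild u hu h
  refine ⟨fun v => hlabels (hinv v).1, fun v c hc hrange => ?_⟩
  have hcov : ∀ j, v ⋖ c j := fun j => by
    have : c j ∈ Set.range c := ⟨j, rfl⟩
    rwa [hrange] at this
  have hinj : Function.Injective fun j => N.port (c j) := fun j k hjk =>
    hc (N.port_injective v _ _ (hcov j) (hcov k) hjk)
  let π : Equiv.Perm (Fin δ) := Equiv.ofBijective _ (Finite.injective_iff_bijective.1 hinj)
  obtain ⟨ρ, hρ⟩ := (hassign (lab v) (hinv v).1 (d v) (ptr v)).1
  refine ⟨ρ.trans π.symm, ?_⟩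
  have hlab : ∀ i, lab (c (π.symm (ρ i))) = assign (lab v) (d v) (ptr v) (ρ i) := by
    intro i
    have hport : N.port (c (π.symm (ρ i))) = ρ i := π.apply_symm_apply (ρ i)
    rw [hall _ (RootedTree.ne_bot_of_covBy (hcov _)), RootedTree.pred_eq_of_covBy (hcov _), hport]
  simp only [Equiv.trans_apply, hlab]
  exact hconfigs hρ

end Network

/-! ### The algorithm -/

/-- The state of a node. -/
structure NodeState (δ : ℕ) (α : Type u) where
  /-- the identifiers of the ancestors found so far, the most distant one first -/
  hist : List ℕ
  /-- the number of alive nodes of the ruling set seen below, capped at `2` -/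
  cnt : ℕ
  /-- the port of the only child that has to be respected -/
  ptr : Option (Fin δ)
  /-- whether the path to the node follows the pointers -/
  track : Prop
  /-- the capped number of steps to the first anchor -/
  dist : ℕ
  /-- the current label -/
  lab : α

namespace NodeState

variable {δ : ℕ} {α : Type u}

/-- The node belongs to the ruling set. -/
def InRuling (D m : ℕ) (x : NodeState δ α) : Prop :=
  ColeVishkin.IsRuler D m fun i => x.hist.reverse.getD i 0

/-- The node is an anchor. -/
def IsAnchor (D m : ℕ) (x : NodeState δ α) : Prop := x.InRuling D m ∧ x.track

end NodeState

namespace Instr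

variable {δ : ℕ} {α : Type u}

/-- Learn the identifier of one more ancestor. -/
def gather (M : ℕ) : Instr δ (NodeState δ α) where
  send x _ := x.hist.headD 0
  -- After `t` rounds the history has length `t + 1`, so the default is the virtual identifier `M +
  -- t + 1` of `ancId`.
  update x inb := { x with hist := (inb .parent).getD (M + x.hist.length) :: x.hist }

open Classical in
/-- One step of raking and compressing. -/
noncomputable def rake (D m : ℕ) : Instr δ (NodeState δ α) where
  send x _ := Network.signal (x.InRuling D m) x.cnt
  update x inb :=
    { x with
      cnt := min 2 (∑ i, (inb (.child i)).getD 0)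
      ptr := if 2 ≤ x.cnt then Network.pick fun i => (inb (.child i)).getD 0 else x.ptr }

open Classical in
/-- Check whether the path to the node follows the pointers on one more edge. -/
noncomputable def follow : Instr δ (NodeState δ α) where
  send x
    | .parent => 0
    | .child i => if x.ptr = some i ∧ x.track then 1 else 0
  update x inb := { x with track := inb .parent = some 1 }

open Classical in
/-- Look for anchors one step further below. -/
noncomputable def measure (D m K : ℕ) : Instr δ (NodeState δ α) where
  send x _ := x.dist
  update x inb :=
    { x with
      dist := if x.IsAnchor D m then 0 else
        x.ptr.elim (K + 1) fun i => min (K + 1) ((inb (.child i)).getD (K + 1) + 1) }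

open Classical in
/-- Adopt the label assigned by the parent and assign labels to the children. -/
noncomputable def label (D m : ℕ) (s : α) (start : ℕ → α)
    (assign : α → ℕ → Option (Fin δ) → Fin δ → α) (code : α → ℕ) (decode : ℕ → α) :
    Instr δ (NodeState δ α) where
  send x
    | .parent => 0
    | .child i => code (assign x.lab x.dist x.ptr i)
  update x inb :=
    { x with
      lab := if x.IsAnchor D m then s else (inb .parent).elim (start x.dist) decode }

end Instr

/-! ### What each phase of the program computes -/

namespace Network

variable {δ : ℕ} {T : RootedTree.{0}} (N : Network δ T) {α : Type u} {m : ℕ}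
  {σ : T → NodeState δ α}

lemma natInbox_parent_bot (out : T → Port δ → ℕ) : N.natInbox out ⊥ .parent = none := by
  simp [natInbox]

lemma natInbox_parent {v : T} (hv : v ≠ ⊥) (out : T → Port δ → ℕ) :
    N.natInbox out v .parent = some (out (Order.pred v) (.child (N.port v))) := by
  simp [natInbox, hv]

lemma natInbox_child_getD (out : T → Port δ → ℕ) (v : T) (i : Fin δ) (x : ℕ) :
    (N.natInbox out v (.child i)).getD x = (N.childAt v i).elim x fun u => out u .parent := by
  simp only [natInbox]
  cases N.childAt v i <;> rfl

lemma run_gather {M t : ℕ} (hM : ∀ v, N.ident v ≤ M) (hm : M + t < 2 ^ m)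
    (hσ : ∀ v, (σ v).hist = [N.ident v]) :
    N.run m (List.replicate t (.gather M)) σ = fun v =>
      { σ v with hist := ((List.range (t + 1)).map fun i => N.ancId M i v).reverse } := by
  induction t with
  | zero =>
    funext v
    have : ((List.range (0 + 1)).map fun i => N.ancId M i v).reverse = (σ v).hist := by
      simp [hσ, ancId]
    rw [this]
    rfl
  | succ t ih =>
    rw [run_replicate_succ, ih (by omega)]
    funext v
    simp only [exec, Instr.gather, NodeState.mk.injEq, and_true]
    rw [List.range_succ (n := t + 1), List.map_append, List.reverse_append]
    simp only [List.map_cons, List.map_nil, List.reverse_cons, List.reverse_nil, List.nil_append,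
      List.cons_append, List.cons.injEq, and_true]
    by_cases hv : v = ⊥
    · subst hv
      simp [natInbox_parent_bot, ancId, Nat.add_assoc]
    · have hle := N.ancId_le hM t (Order.pred v)
      rw [N.natInbox_parent hv, N.ancId_succ hv, List.range_succ, List.map_append,
        List.reverse_append]
      simp [Nat.mod_eq_of_lt (show N.ancId M t (Order.pred v) < 2 ^ m by omega)]

lemma run_rake {D t : ℕ} {Y : T → Prop} (hY : ∀ v, (σ v).InRuling D m ↔ Y v) (hm : 2 < 2 ^ m)
    (hcnt : ∀ v, (σ v).cnt = 2)
    (hptr : ∀ v, (σ v).ptr = none) :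
    N.run m (List.replicate t (.rake D m)) σ = fun v =>
      { σ v with
        cnt := N.count Y t v
        ptr := N.pointer Y t v } := by
  obtain rfl : (fun v => (σ v).InRuling D m) = Y := funext fun v => propext (hY v)
  induction t with
  | zero =>
    funext v
    rw [count, pointer, ← hcnt v, ← hptr v]
    rfl
  | succ t ih =>
    rw [run_replicate_succ, ih]
    funext v
    have hmod : ∀ (y : Prop) (u : T), signal y (N.count (fun v => (σ v).InRuling D m) t u) % 2 ^ m =
        signal y (N.count (fun v => (σ v).InRuling D m) t u) := fun y u => by
      refine Nat.mod_eq_of_lt (lt_of_le_of_lt ?_ hm)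
      have := N.count_le_two (Y := fun v => (σ v).InRuling D m) t u
      unfold signal
      split_ifs <;> omega
    simp only [exec, Instr.rake, natInbox_child_getD, count, pointer, hmod]
    rfl

lemma run_follow {t : ℕ} {ptr : T → Option (Fin δ)} (hptr : ∀ v, (σ v).ptr = ptr v)
    (hm : 2 < 2 ^ m) (htrack : ∀ v, (σ v).track = True) :
    N.run m (List.replicate t .follow) σ = fun v =>
      { σ v with track := N.OnTrack ptr t v } := by
  obtain rfl : (fun v => (σ v).ptr) = ptr := funext hptr
  induction t with
  | zero =>
    funext v
    rw [OnTrack, ← htrack v]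
    rfl
  | succ t ih =>
    rw [run_replicate_succ, ih]
    funext v
    simp only [exec, Instr.follow, OnTrack, NodeState.mk.injEq, and_true, true_and]
    by_cases hv : v = ⊥
    · subst hv
      simp [natInbox_parent_bot]
    · rw [N.natInbox_parent hv]
      have h1 : 1 % 2 ^ m = 1 := Nat.mod_eq_of_lt (by omega)
      dsimp only
      split_ifs with h
      · simp [hv, h, h1]
      · simpa [hv] using h

lemma run_measure {D K t : ℕ} {A : T → Prop} {ptr : T → Option (Fin δ)}
    (hA : ∀ v, (σ v).IsAnchor D m ↔ A v) (hptr : ∀ v, (σ v).ptr = ptr v) (hm : K + 1 < 2 ^ m) (hdist : ∀ v, (σ v).dist = K + 1) :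
    N.run m (List.replicate t (.measure D m K)) σ = fun v =>
      { σ v with dist := N.pointerDist ptr A K t v } := by
  obtain rfl : (fun v => (σ v).IsAnchor D m) = A := funext fun v => propext (hA v)
  obtain rfl : (fun v => (σ v).ptr) = ptr := funext hptr
  induction t with
  | zero =>
    funext v
    rw [pointerDist, ← hdist v]
    rfl
  | succ t ih =>
    rw [run_replicate_succ, ih]
    funext v
    have hmod : ∀ u, N.pointerDist (fun v => (σ v).ptr) (fun v => (σ v).IsAnchor D m) K t u % 2 ^ m =
        N.pointerDist (fun v => (σ v).ptr) (fun v => (σ v).IsAnchor D m) K t u := fun u =>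
      Nat.mod_eq_of_lt ((N.pointerDist_le t u).trans_lt hm)
    simp only [exec, Instr.measure, natInbox_child_getD, pointerDist, hmod]
    rfl

lemma run_label {D t : ℕ} {s : α} {start : ℕ → α}
    {assign : α → ℕ → Option (Fin δ) → Fin δ → α} {code : α → ℕ} {decode : ℕ → α}
    {A : T → Prop} {d : T → ℕ} {ptr : T → Option (Fin δ)} (hA : ∀ v, (σ v).IsAnchor D m ↔ A v)
    (hd : ∀ v, (σ v).dist = d v) (hptr : ∀ v, (σ v).ptr = ptr v)
    (hcode : ∀ a d p i, code (assign a d p i) < 2 ^ m ∧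
      decode (code (assign a d p i)) = assign a d p i) (hlab : ∀ v, (σ v).lab = s) :
    N.run m (List.replicate t (.label D m s start assign code decode)) σ = fun v =>
      { σ v with lab := N.labelAt A d ptr s start assign t v } := by
  obtain rfl : (fun v => (σ v).IsAnchor D m) = A := funext fun v => propext (hA v)
  obtain rfl : (fun v => (σ v).dist) = d := funext hd
  obtain rfl : (fun v => (σ v).ptr) = ptr := funext hptr
  induction t with
  | zero =>
    funext v
    rw [labelAt, ← hlab v]
    rfl
  | succ t ih =>
    rw [run_replicate_succ, ih]
    funext v
    simp only [exec, Instr.label, labelAt, NodeState.mk.injEq, true_and]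
    by_cases hA : (σ v).IsAnchor D m
    · exact (if_pos hA).trans (if_pos hA).symm
    refine (if_neg hA).trans (Eq.trans ?_ (if_neg hA).symm)
    by_cases hv : v = ⊥
    · subst hv
      simp [natInbox_parent_bot]
    · rw [N.natInbox_parent hv, if_neg hv, Option.elim_some, Nat.mod_eq_of_lt (hcode _ _ _ _).1,
        (hcode _ _ _ _).2]

end Network

/-! ### Correctness of the whole program -/

namespace Network

variable {δ : ℕ} {T : RootedTree.{0}} (N : Network δ T)

/-- The ruling set determined by the identifiers of the ancestors. -/
def Ruling (D m M : ℕ) (v : T) : Prop := ColeVishkin.IsRuler D m fun i => N.ancId M i v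

lemma not_ruling_iterate_pred {D m M : ℕ} {y : T} {e : ℕ} (hy : N.Ruling D m M y) (he : 0 < e)
    (heD : e ≤ D) (hbot : ∀ k < e, Order.pred^[k] y ≠ ⊥) :
    ¬ N.Ruling D m M (Order.pred^[e] y) := by
  have := ColeVishkin.IsRuler.not_isRuler_shift he heD hy
  simp only [N.ancId_add hbot] at this
  exact this

lemma exists_ruling_above {D m M : ℕ} (hM : ∀ v, N.ident v ≤ M)
    (hm : M + (2 * 8 ^ D * D + 2 * D + D * m) < 2 ^ m) (v : T) :
    ∃ i < 2 * 8 ^ D * D + 1, N.Ruling D m M (Order.pred^[i] v) ∨ Order.pred^[i] v = ⊥ := by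
  obtain ⟨i, hi, hr⟩ := ColeVishkin.exists_isRuler_shift (D := D) (s := m)
    (N.ancId_injective hM v) fun i hi => (N.ancId_le hM i v).trans_lt (by omega)
  by_cases hbot : ∀ k < i, Order.pred^[k] v ≠ ⊥
  · refine ⟨i, by omega, .inl ?_⟩
    simp only [N.ancId_add hbot] at hr
    exact hr
  · push Not at hbot
    obtain ⟨k, hk, h⟩ := hbot
    exact ⟨k, by omega, .inr h⟩

end Network

/-- The state of a node before the first round. -/
def NodeState.initial {α : Type u} (δ K : ℕ) (s : α) (x : NodeInput) : NodeState δ α where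
  hist := [x.ident]
  cnt := 2
  ptr := none
  track := True
  dist := K + 1
  lab := s

/-- The rounds of the algorithm. -/
noncomputable def logProgram {δ : ℕ} {α : Type u} (K m M H : ℕ) (s : α) (start : ℕ → α)
    (assign : α → ℕ → Option (Fin δ) → Fin δ → α) (code : α → ℕ) (decode : ℕ → α) :
    List (Instr δ (NodeState δ α)) :=
  List.replicate (2 * (K + 1) + (K + 1) * m) (.gather M) ++
    List.replicate H (.rake (K + 1) m) ++
    List.replicate (K + 1) .follow ++
    List.replicate (K + 1) (.measure (K + 1) m K) ++
    List.replicate (H + 1 + (K + 1) + 1) (.label (K + 1) m s start assign code decode)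

lemma isSolution_logProgram {δ : ℕ} {α : Type u} {P Q : LCL δ α} {T : RootedTree.{0}} [Fintype T]
    (N : Network δ T) {K m M H : ℕ} {s : α} {start : ℕ → α}
    {assign : α → ℕ → Option (Fin δ) → Fin δ → α} {code : α → ℕ} {decode : ℕ → α}
    (hlabels : Q.labels ⊆ P.labels) (hconfigs : Q.configs ⊆ P.configs) (hs : s ∈ Q.labels)
    (hK : ∀ a ∈ Q.labels, Q.HasWalk K a s)
    (hstart : ∀ d, start d ∈ Q.labels ∧ (d ≤ K → Q.HasWalk d (start d) s))
    (hmem : ∀ a d p i, assign a d p i ∈ Q.labels)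
    (hassign : ∀ a ∈ Q.labels, ∀ d p, (∃ ρ : Equiv.Perm (Fin δ),
          (a, fun i => assign a d p (ρ i)) ∈ Q.configs) ∧
        ∀ k i, d = k + 1 → p = some i → Q.HasWalk (k + 1) a s →
          Q.HasWalk k (assign a d p i) s)
    (hcode : ∀ a ∈ Q.labels, code a < 2 ^ m ∧ decode (code a) = a)
    (hM : ∀ v, N.ident v ≤ M)
    (hm : M + (2 * 8 ^ (K + 1) * (K + 1) + 2 * (K + 1) + (K + 1) * m) < 2 ^ m)
    (hH : H = (2 * 8 ^ (K + 1) * (K + 1) + 1) * (Nat.log 2 (Fintype.card T) + 1)) :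
    P.IsSolution T fun v =>
      (N.run m (logProgram K m M H s start assign code decode)
        (fun u => .initial δ K s (N.input u)) v).lab := by
  set Y : T → Prop := N.Ruling (K + 1) m M with hY
  set ptr : T → Option (Fin δ) := N.pointer Y H with hptr
  set A : T → Prop := fun v => Y v ∧ N.OnTrack ptr (K + 1) v with hA
  set d : T → ℕ := N.pointerDist ptr A K (K + 1) with hd
  set lab : ℕ → T → α := N.labelAt A d ptr s start assign with hlab
  have hrun : (fun v => (N.run m (logProgram K m M H s start assign code decode)
      (fun u => .initial δ K s (N.input u)) v).lab) = lab (H + 1 + (K + 1) + 1) := by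
    set hist : T → List ℕ := fun v =>
      ((List.range (2 * (K + 1) + (K + 1) * m + 1)).map fun i => N.ancId M i v).reverse with hhist
    -- Being a ruler depends only on the gathered entries, so the default 0 beyond the history is
    -- harmless.
    have hruling : ∀ v, ColeVishkin.IsRuler (K + 1) m (fun i => (hist v).reverse.getD i 0) ↔ Y v :=
      fun v => ColeVishkin.isRuler_congr fun i hi => by
        rw [hhist, List.reverse_reverse, List.getD_eq_getElem _ _ (by simp; omega)]
        simp
    have e1 := N.run_gather (m := m) (σ := fun u => .initial δ K s (N.input u)) (M := M)
      (t := 2 * (K + 1) + (K + 1) * m) hM (by omega) fun _ => rfl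
    have e2 := N.run_rake (m := m) (D := K + 1) (t := H) (Y := Y)
      (σ := fun v => ⟨hist v, 2, none, True, K + 1, s⟩) hruling (by omega) (fun _ => rfl)
      fun _ => rfl
    have e3 := N.run_follow (m := m) (t := K + 1) (ptr := ptr)
      (σ := fun v => ⟨hist v, N.count Y H v, ptr v, True, K + 1, s⟩) (fun _ => rfl) (by omega)
      fun _ => rfl
    have e4 := N.run_measure (m := m) (D := K + 1) (K := K) (t := K + 1) (A := A) (ptr := ptr)
      (σ := fun v => ⟨hist v, N.count Y H v, ptr v, N.OnTrack ptr (K + 1) v, K + 1, s⟩)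
      (fun v => and_congr_left' (hruling v)) (fun _ => rfl) (by omega) fun _ => rfl
    have e5 := N.run_label (m := m) (D := K + 1) (t := H + 1 + (K + 1) + 1) (s := s)
      (start := start) (A := A) (d := d) (ptr := ptr)
      (σ := fun v => ⟨hist v, N.count Y H v, ptr v, N.OnTrack ptr (K + 1) v, d v, s⟩)
      (fun v => and_congr_left' (hruling v)) (fun _ => rfl) (fun _ => rfl)
      (fun a d p i => hcode _ (hmem a d p i)) fun _ => rfl
    simp only [logProgram, Network.run_append]
    erw [e1, e2, e3, e4, e5]
  rw [hrun]
  have hcount : ∀ v, N.count Y H v < 2 := by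
    intro v
    rw [hH]
    exact N.count_lt_two (N.exists_ruling_above hM hm) v
  have hspace : ∀ (y : T) (e : ℕ), Y y → 0 < e → e ≤ K + 1 → (∀ k < e, Order.pred^[k] y ≠ ⊥) →
      ¬ Y (Order.pred^[e] y) := fun y e hy he heD hbot => N.not_ruling_iterate_pred hy he heD hbot
  have hstable : ∀ v, lab (H + 1 + (K + 1) + 2) v = lab (H + 1 + (K + 1) + 1) v := by
    intro v
    obtain ⟨i, hi, h⟩ := N.exists_anchor_above hcount hspace v
    exact N.labelAt_succ_eq h (by omega)
  have hdfix : ∀ v, ¬ A v → d v = (ptr v).elim (K + 1) fun i =>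
      min (K + 1) ((N.childAt v i).elim (K + 1) d + 1) := by
    intro v hv
    have h := N.pointerDist_fixed (ptr := ptr) (A := A) (K := K) v
    rw [Network.pointerDist, if_neg hv] at h
    exact h.symm
  refine N.isSolution_of_stable (A := A) (d := d) (ptr := ptr) hlabels hconfigs hs hK hstart hmem
    hassign ?_ ?_ ?_ ?_ ?_
  · intro v hv
    rw [hd, Network.pointerDist, if_pos hv]
  -- The anchor `y` lies `d u < K` edges below `u`, and `K + 1` edges above `y` follow pointers, so
  -- the edge from `u` to its parent is one of them.
  · intro u hu hdu
    obtain ⟨y, hy, hyA⟩ := N.exists_of_pointerDist_le (ptr := ptr) (A := A) (k := K + 1) (v := u)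
      hdu.le
    rw [← hd] at hy
    have htrack := N.onTrack_iff.1 hyA.2
    have hup := (htrack (d u) (by omega)).2
    rw [Function.iterate_succ_apply', hy] at hup
    refine ⟨hup, ?_⟩
    -- The parent is within `K + 1` of `y`, hence not in `Y`, and its own distance is not reset to
    -- 0.
    have hnot : ¬ A (Order.pred u) := fun h => by
      refine hspace y (d u + 1) hyA.1 (by omega) (by omega)
        (fun k hk => (htrack k (by omega)).1) ?_
      rw [Function.iterate_succ_apply', hy]
      exact h.1
    rw [hdfix _ hnot, hup, Option.elim_some, N.childAt_pred hu, Option.elim_some,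
      min_eq_right (by omega)]
  · intro v hv
    rw [hlab, Network.labelAt, if_pos hv]
  · intro h
    rw [hlab, Network.labelAt, if_neg h, if_pos rfl]
  · intro u hu hAu
    rw [← hstable, hlab, Network.labelAt, if_neg hAu, if_neg hu]

/-! ### Logarithmic bounds for rounds and messages -/

lemma isBigO_log_of_le {f : ℕ → ℕ} {a b : ℕ} (h : ∀ n, f n ≤ a * Nat.log 2 n + b) :
    (fun n => (f n : ℝ)) =O[Filter.atTop] (fun n : ℕ => Real.log n) := by
  refine Asymptotics.IsBigO.of_bound (a / Real.log 2 + b) ?_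
  have hlog := (Real.tendsto_log_atTop.comp tendsto_natCast_atTop_atTop).eventually_ge_atTop 1
  filter_upwards [hlog] with n hn
  simp only [Function.comp_apply] at hn
  rw [Real.norm_of_nonneg (by positivity), Real.norm_of_nonneg (by linarith)]
  have h1 : (f n : ℝ) ≤ a * Nat.log 2 n + b := by exact_mod_cast h n
  have h2 : (Nat.log 2 n : ℝ) ≤ Real.log n / Real.log 2 := by
    have := Real.natLog_le_logb n 2
    rwa [Real.logb, Nat.cast_ofNat] at this
  have h3 := mul_le_mul_of_nonneg_left h2 (Nat.cast_nonneg (α := ℝ) a)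
  have h4 := mul_le_mul_of_nonneg_left hn (Nat.cast_nonneg (α := ℝ) b)
  calc (f n : ℝ) ≤ a * (Real.log n / Real.log 2) + b * Real.log n := by linarith
    _ = (a / Real.log 2 + b) * Real.log n := by ring

lemma eval_le_mul_pow (p : Polynomial ℕ) {n : ℕ} (hn : 0 < n) :
    p.eval n ≤ p.eval 1 * n ^ p.natDegree := by
  rw [Polynomial.eval_eq_sum_range, Polynomial.eval_eq_sum_range, Finset.sum_mul]
  refine Finset.sum_le_sum fun i hi => ?_
  rw [one_pow, mul_one]
  exact Nat.mul_le_mul_left _ (Nat.pow_le_pow_right hn (by simpa [Nat.lt_succ_iff] using hi))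

/-- Enough bits for numbers that are polynomial in `n` and linear in the number of bits. -/
lemma exists_bits (p : Polynomial ℕ) (B D : ℕ) :
    ∃ (a b : ℕ) (m : ℕ → ℕ), (∀ n, m n ≤ a * Nat.log 2 n + b) ∧
      ∀ n, 0 < n → p.eval n + B + D * m n < 2 ^ m n := by
  set c := p.eval 1 + B with hc
  set q := p.natDegree with hq
  -- The first two summands of the bit length cover `p.eval n + B`; the extra `2 * D + 4` makes the
  -- power also dominate `D` times the bit length itself.
  refine ⟨q, c + q + 2 * D + 4, fun n => c + q * (Nat.log 2 n + 1) + 2 * D + 4,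
    fun n => by simp only [Nat.mul_succ]; omega, fun n hn => ?_⟩
  set z := c + q * (Nat.log 2 n + 1) with hz
  have h1 : p.eval n + B < 2 ^ z := by
    have hpow : n ^ q ≤ 2 ^ (q * (Nat.log 2 n + 1)) := by
      rw [Nat.mul_comm, pow_mul]
      exact Nat.pow_le_pow_left (Nat.lt_pow_succ_log_self (by norm_num) n).le q
    have hpos : 1 ≤ n ^ q := Nat.one_le_pow _ _ hn
    calc p.eval n + B ≤ p.eval 1 * n ^ q + B * n ^ q :=
          Nat.add_le_add (eval_le_mul_pow p hn) (Nat.le_mul_of_pos_right _ hpos)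
      _ = c * n ^ q := by rw [hc, Nat.add_mul]
      _ < 2 ^ c * n ^ q := Nat.mul_lt_mul_of_pos_right Nat.lt_two_pow_self hpos
      _ ≤ 2 ^ c * 2 ^ (q * (Nat.log 2 n + 1)) := Nat.mul_le_mul_left _ hpow
      _ = 2 ^ z := by rw [← pow_add]
  have h2 : z + 2 * D + 4 ≤ 2 ^ (z + D + 3) := by
    have := Nat.lt_two_pow_self (n := z + D)
    rw [pow_add]
    omega
  have h3 : D * (z + 2 * D + 4) ≤ 2 ^ (z + 2 * D + 3) := by
    calc D * (z + 2 * D + 4) ≤ 2 ^ D * 2 ^ (z + D + 3) :=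
          Nat.mul_le_mul Nat.lt_two_pow_self.le h2
      _ = 2 ^ (z + 2 * D + 3) := by rw [← pow_add]; congr 1; omega
  have h4 : 2 ^ z ≤ 2 ^ (z + 2 * D + 3) := Nat.pow_le_pow_right (by norm_num) (by omega)
  have h5 : 2 ^ (z + 2 * D + 4) = 2 ^ (z + 2 * D + 3) * 2 := pow_succ ..
  change p.eval n + B + D * (z + 2 * D + 4) < 2 ^ (z + 2 * D + 4)
  omega

lemma Set.Finite.exists_code {α : Type u} {S : Set α} (hS : S.Finite) (s : α) :
    ∃ (B : ℕ) (code : α → ℕ) (decode : ℕ → α), ∀ a ∈ S, code a < B ∧ decode (code a) = a := by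
  classical
  refine ⟨hS.toFinset.toList.length, fun a => hS.toFinset.toList.idxOf a,
    fun i => hS.toFinset.toList.getD i s, fun a ha => ?_⟩
  have hlt : hS.toFinset.toList.idxOf a < hS.toFinset.toList.length :=
    List.idxOf_lt_length_iff.2 (by simpa using ha)
  exact ⟨hlt, (List.getD_eq_getElem _ _ hlt).trans (List.getElem_idxOf hlt)⟩

theorem mainTheorem1 {δ : ℕ} (hδ : 0 < δ) {α : Type u} (P : LCL δ α)
    (hP : P.HasLogCertificate) :
    P.SolvableInCongest (fun n => Real.log n) := by
  obtain ⟨Q, s, K, hs, hlabels, hconfigs, hcfg, hK⟩ := hP.exists_absorbing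
  obtain ⟨assign, hmem, hassign⟩ := LCL.exists_assign hs hcfg
  obtain ⟨start, hstart⟩ := LCL.exists_start hs hK
  obtain ⟨B, code, decode, hcode⟩ := Q.finite_labels.exists_code s
  refine P.solvableInCongest_of_programs _ fun p => ?_
  set R := 2 * 8 ^ (K + 1) * (K + 1) with hR
  obtain ⟨a, b, m, hmle, hm⟩ := exists_bits p (R + 2 * (K + 1) + B) (K + 1)
  refine ⟨NodeState δ α, fun n => logProgram K (m n) (p.eval n) ((R + 1) * (Nat.log 2 n + 1)) s
    start assign code decode, m, .initial δ K s, NodeState.lab, ?_, isBigO_log_of_le hmle, ?_⟩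
  -- Gathering costs `(K + 1) * m n` rounds and raking and labeling cost about `(R + 1) * (Nat.log 2
  -- n + 1)` each, up to constants; `6 * K + 10` leaves slack.
  · refine isBigO_log_of_le (a := (K + 1) * a + 2 * (R + 1))
      (b := (K + 1) * b + 2 * (R + 1) + 6 * K + 10) fun n => ?_
    have := Nat.mul_le_mul_left (K + 1) (hmle n)
    simp only [logProgram, List.length_append, List.length_replicate]
    linarith
  · intro T _ _ N hN
    have hm' := hm (Fintype.card T) (Fintype.card_pos_iff.2 ⟨⊥⟩)
    refine isSolution_logProgram N hlabels hconfigs hs hK hstart hmem hassign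
      (fun a ha => ⟨(hcode a ha).1.trans (by omega), (hcode a ha).2⟩)
      (fun v => (Finset.mem_Icc.1 (hN v)).2) ?_ rfl
    rw [← hR]
    omega
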